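/- Let $r\ge 1$ and let $(M,\omega)$ be a closed (compact, without boundary) symplectic manifold on which the cyclic group $\mathbb{Z}_r$ acts smoothly with non-empty fixed point set $F=M^{\mathbb{Z}_r}$. Let $g\colon M\to M$ be the diffeomorphism given by a generator of $\mathbb{Z}_r$, and suppose that $g$ is smoothly isotopic, through diffeomorphisms of $M$, to a symplectomorphism of $(M,\omega)$. Let $T(g)=\mathbb{R}\times M/\big((t+1,x)\sim(t,gx)\big)$ be the mapping torus of $g$. Then: (1) the manifold $S^1\times T(g)$ admits a symplectic form; (2) there is a smooth action of the circle group $S^1$ on $S^1\times T(g)$ which has no fixed points and whose $\mathbb{Z}_r$-isotropy point set $\{y : (S^1)_y=\mathbb{Z}_r\}$ is diffeomorphic to $S^1\times S^1\times F$, where $(S^1)_y$ denotes the isotropy group of $y$ and $\mathbb{Z}_r\subset S^1$ is the group of $r$-th roots of unity; (3) if $S^1\times S^1\times F$ is not a symplectic manifold, then the action in (2) is not symplectic, i.e. $S^1\times T(g)$ has no symplectic form invariant under this action. Here $F$, $S^1\times S^1\times F$ and the isotropy point set carry the smooth structures induced from the ambient manifolds $M$, $S^1\times S^1\times M$ and $S^1\times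 T(g)$. Their connected components may have different dimensions, and such a manifold is called symplectic if each of its components admits a symplectic form. -/

import Mathlib

open scoped Manifold ContDiff Topology
open Set

universe u

noncomputable section

/-! ## Quotients of manifolds by free, properly discontinuous smooth actions -/

/-- The quotient of a `C^n` manifold by a free, properly discontinuous action of a group of `C^n`
transformations is a `C^n` manifold, for the charts obtained by composing local inverses of the
projection with charts upstairs. -/
theorem isManifold_orbitRel_quotient {E : Type*} [NormedAddCommGroup E] [NormedSpace ℝ E]
    {H : Type*} [TopologicalSpace H] (I : ModelWithCorners ℝ E H) (n : WithTop ℕ∞)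
    {X : Type*} [TopologicalSpace X] [ChartedSpace H X] [IsManifold I n X]
    [T2Space X] [LocallyCompactSpace X]
    {G : Type*} [Group G] [MulAction G X] [ProperlyDiscontinuousSMul G X]
    [ContinuousConstSMul G X] [IsCancelSMul G X]
    (hG : ∀ a : G, ContMDiff I I n (fun x : X => a • x)) :
    IsManifold I n (MulAction.orbitRel.Quotient G X) := by
  apply isManifold_of_contDiffOn
  have key : ∀ e e' : OpenPartialHomeomorph (MulAction.orbitRel.Quotient G X) H,
      e ∈ atlas H (MulAction.orbitRel.Quotient G X) →
      e' ∈ atlas H (MulAction.orbitRel.Quotient G X) →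
      ContMDiffOn I I n (e.symm.trans e') (e.symm.trans e').source := by
    rintro e e' ⟨p, rfl⟩ ⟨q, rfl⟩
    set F : X → MulAction.orbitRel.Quotient G X := Quotient.mk (MulAction.orbitRel G X) with hF
    have hloc : IsLocalHomeomorph F :=
      (isQuotientCoveringMap_quotientMk_of_properlyDiscontinuousSMul
        (G := G) (E := X)).isCoveringMap.isLocalHomeomorph
    have main : ∀ a b : X, ContMDiffOn I I n
        (((hloc.localInverseAt a).trans (chartAt H a)).symm.trans
          ((hloc.localInverseAt b).trans (chartAt H b)))
        (((hloc.localInverseAt a).trans (chartAt H a)).symm.trans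
          ((hloc.localInverseAt b).trans (chartAt H b))).source := by
      intro a b y hy
      simp only [OpenPartialHomeomorph.trans_source, OpenPartialHomeomorph.symm_source,
        mem_inter_iff, mem_preimage, OpenPartialHomeomorph.trans_symm_eq_symm_trans_symm,
        OpenPartialHomeomorph.coe_trans, Function.comp_apply,
        IsLocalHomeomorph.localInverseAt_symm] at hy
      obtain ⟨⟨hy1, hy2⟩, hy3, hy4⟩ := hy
      set z : X := (chartAt H a).symm y with hz
      have hw : F (hloc.localInverseAt b (F z)) = F z :=
        hloc.apply_localInverseAt_of_mem hy3
      obtain ⟨c, hc⟩ : hloc.localInverseAt b (F z) ∈ MulAction.orbit G z :=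
        MulAction.orbitRel_apply.1 (Quotient.exact hw)
      have hc' : c • z = hloc.localInverseAt b (F z) := hc
      have hct : c • z ∈ (hloc.localInverseAt b).target := by
        rw [hc']; exact (hloc.localInverseAt b).map_source hy3
      have hev : ∀ᶠ y' in 𝓝 y, hloc.localInverseAt b (F ((chartAt H a).symm y'))
          = c • (chartAt H a).symm y' := by
        have hcont : ContinuousAt (fun y' => c • (chartAt H a).symm y') y :=
          ((chartAt H a).continuousAt_symm hy1).const_smul c
        have := hcont.preimage_mem_nhds ((hloc.localInverseAt b).open_target.mem_nhds hct)
        filter_upwards [this] with y' hy'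
        have h1 : F ((chartAt H a).symm y') = (hloc.localInverseAt b).symm
            (c • (chartAt H a).symm y') := by
          rw [hloc.localInverseAt_symm]
          exact Quotient.sound (MulAction.orbitRel_apply.2 ⟨c⁻¹, by simp⟩)
        rw [h1, (hloc.localInverseAt b).right_inv hy']
      have hsm : ContMDiffAt I I n
          (fun y' => chartAt H b (c • (chartAt H a).symm y')) y := by
        have h1 : ContMDiffAt I I n (chartAt H a).symm y :=
          contMDiffAt_symm_of_mem_maximalAtlas (IsManifold.chart_mem_maximalAtlas a) hy1
        have h2 : ContMDiffAt I I n (fun y' => c • (chartAt H a).symm y') y :=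
          ContMDiffAt.comp y (hG c).contMDiffAt h1
        have h3 : ContMDiffAt I I n (chartAt H b) (c • (chartAt H a).symm y) := by
          refine contMDiffAt_of_mem_maximalAtlas (IsManifold.chart_mem_maximalAtlas b) ?_
          rw [← hz, hc']; exact hy4
        exact ContMDiffAt.comp y h3 h2
      refine (hsm.congr_of_eventuallyEq ?_).contMDiffWithinAt
      filter_upwards [hev] with y' hy'
      simp only [OpenPartialHomeomorph.coe_trans, Function.comp_apply,
        OpenPartialHomeomorph.trans_symm_eq_symm_trans_symm,
        IsLocalHomeomorph.localInverseAt_symm]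
      rw [hy']
    exact main _ _
  intro e e' he he'
  rw [← contMDiffOn_iff_contDiffOn]
  refine I.contMDiff.comp_contMDiffOn ((key e e' he he').comp (I.contMDiffOn_symm.mono ?_) ?_)
  · exact inter_subset_right
  · exact inter_subset_left

section MappingTorus

variable {E : Type*} [NormedAddCommGroup E] [NormedSpace ℝ E] {H : Type*} [TopologicalSpace H]
  {I : ModelWithCorners ℝ E H} {M : Type*} [TopologicalSpace M] [ChartedSpace H M]

/-- Iterates of a diffeomorphism are smooth. -/
theorem contMDiff_diffeomorph_zpow (g : M ≃ₘ⟮I, I⟯ M) (n : ℤ) :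
    ContMDiff I I ∞ ⇑((g.toEquiv : Equiv.Perm M) ^ n) := by
  have hnat : ∀ (f : M ≃ₘ⟮I, I⟯ M) (k : ℕ),
      ContMDiff I I ∞ ⇑((f.toEquiv : Equiv.Perm M) ^ k) := by
    intro f k
    induction k with
    | zero => exact contMDiff_id
    | succ k ih =>
      rw [pow_succ]
      exact ih.comp f.contMDiff
  cases n with
  | ofNat k => simpa using hnat g k
  | negSucc k =>
    rw [zpow_negSucc, ← inv_pow]
    exact hnat g.symm (k + 1)

/-! ## The mapping torus -/

/-- The infinite cyclic cover `ℝ × M` of the mapping torus of `g`. -/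
def MappingTorusCover (_g : M ≃ₘ⟮I, I⟯ M) : Type _ := ℝ × M

namespace MappingTorusCover

variable (g : M ≃ₘ⟮I, I⟯ M)

instance : TopologicalSpace (MappingTorusCover g) := inferInstanceAs (TopologicalSpace (ℝ × M))

instance : ChartedSpace (ModelProd ℝ H) (MappingTorusCover g) :=
  inferInstanceAs (ChartedSpace (ModelProd ℝ H) (ℝ × M))

instance [IsManifold I ∞ M] : IsManifold (𝓘(ℝ, ℝ).prod I) ∞ (MappingTorusCover g) :=
  inferInstanceAs (IsManifold (𝓘(ℝ, ℝ).prod I) ∞ (ℝ × M))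

instance [T2Space M] : T2Space (MappingTorusCover g) := inferInstanceAs (T2Space (ℝ × M))

instance [LocallyCompactSpace M] : LocallyCompactSpace (MappingTorusCover g) :=
  inferInstanceAs (LocallyCompactSpace (ℝ × M))

/-- The integer `n` acts on `ℝ × M` by `(t, x) ↦ (t - n, gⁿ x)`; the generator identifies
`(t + 1, x)` with `(t, g x)`. -/
instance : MulAction (Multiplicative ℤ) (MappingTorusCover g) where
  smul n p := ((p.1 - (n.toAdd : ℝ), ((g.toEquiv : Equiv.Perm M) ^ n.toAdd) p.2) : ℝ × M)
  one_smul p := by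
    change (((p.1 - ((0 : ℤ) : ℝ), ((g.toEquiv : Equiv.Perm M) ^ (0 : ℤ)) p.2) : ℝ × M)) = p
    rw [zpow_zero, Int.cast_zero, sub_zero]
    rfl
  mul_smul a b p := by
    change (((p.1 - ((a.toAdd + b.toAdd : ℤ) : ℝ),
        ((g.toEquiv : Equiv.Perm M) ^ (a.toAdd + b.toAdd)) p.2) : ℝ × M)) =
      (p.1 - (b.toAdd : ℝ) - (a.toAdd : ℝ), ((g.toEquiv : Equiv.Perm M) ^ a.toAdd)
        (((g.toEquiv : Equiv.Perm M) ^ b.toAdd) p.2))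
    rw [zpow_add, Equiv.Perm.mul_apply]
    push_cast
    congr 1
    ring

theorem smul_def (n : Multiplicative ℤ) (p : MappingTorusCover g) :
    n • p = ((p.1 - (n.toAdd : ℝ), ((g.toEquiv : Equiv.Perm M) ^ n.toAdd) p.2) : ℝ × M) := rfl

theorem contMDiff_smul_cover (n : Multiplicative ℤ) :
    ContMDiff (𝓘(ℝ, ℝ).prod I) (𝓘(ℝ, ℝ).prod I) ∞ (fun p : MappingTorusCover g => n • p) := by
  have h1 : ContMDiff 𝓘(ℝ, ℝ) 𝓘(ℝ, ℝ) ∞ (fun t : ℝ => t - (n.toAdd : ℝ)) :=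
    (contDiff_id.sub contDiff_const).contMDiff
  exact (h1.comp contMDiff_fst).prodMk ((contMDiff_diffeomorph_zpow g n.toAdd).comp contMDiff_snd)

instance : ContinuousConstSMul (Multiplicative ℤ) (MappingTorusCover g) :=
  ⟨fun n => (contMDiff_smul_cover g n).continuous⟩

instance : IsCancelSMul (Multiplicative ℤ) (MappingTorusCover g) where
  right_cancel' a b p hab := by
    have h : p.1 - (a.toAdd : ℝ) = p.1 - (b.toAdd : ℝ) := congrArg Prod.fst hab
    have h' : (a.toAdd : ℝ) = (b.toAdd : ℝ) := by linarith
    exact Multiplicative.toAdd.injective (by exact_mod_cast h')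

instance : ProperlyDiscontinuousSMul (Multiplicative ℤ) (MappingTorusCover g) where
  finite_disjoint_inter_image {K L} hK hL := by
    have hfst : Continuous (fun p : MappingTorusCover g => p.1) :=
      (continuous_fst : Continuous (Prod.fst : ℝ × M → ℝ))
    obtain ⟨B, hB⟩ := (hK.image hfst).isBounded.exists_norm_le
    obtain ⟨C, hC⟩ := (hL.image hfst).isBounded.exists_norm_le
    obtain ⟨k, hk⟩ := exists_nat_gt (B + C)
    refine ((Set.finite_Icc (-(k : ℤ)) k).preimage
      (f := fun n : Multiplicative ℤ => n.toAdd) Multiplicative.toAdd.injective.injOn).subset ?_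
    rintro n ⟨q, ⟨p, hp, rfl⟩, hq⟩
    have h1 := abs_le.1 (hB _ ⟨p, hp, rfl⟩)
    have h2 := abs_le.1 (hC _ ⟨_, hq, rfl⟩)
    have h3 : (n • p).1 = p.1 - (n.toAdd : ℝ) := rfl
    simp only [h3] at h2
    have h4 : ((n.toAdd : ℤ) : ℝ) ≤ ((k : ℤ) : ℝ) := by push_cast; linarith
    have h5 : ((-(k : ℤ) : ℤ) : ℝ) ≤ ((n.toAdd : ℤ) : ℝ) := by push_cast; linarith
    exact ⟨by exact_mod_cast h5, by exact_mod_cast h4⟩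

end MappingTorusCover

/-- The mapping torus `T(g)`, the quotient of `ℝ × M` by `(t + 1, x) ∼ (t, g x)`: the bundle over
`ℝ / ℤ` with fibre `M` and gluing diffeomorphism `g`. -/
def MappingTorus (g : M ≃ₘ⟮I, I⟯ M) : Type _ :=
  MulAction.orbitRel.Quotient (Multiplicative ℤ) (MappingTorusCover g)

namespace MappingTorus

variable (g : M ≃ₘ⟮I, I⟯ M)

instance : TopologicalSpace (MappingTorus g) :=
  inferInstanceAs (TopologicalSpace
    (MulAction.orbitRel.Quotient (Multiplicative ℤ) (MappingTorusCover g)))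

variable [T2Space M] [LocallyCompactSpace M]

instance : T2Space (MappingTorus g) :=
  inferInstanceAs (T2Space (Quotient (MulAction.orbitRel (Multiplicative ℤ) (MappingTorusCover g))))

/-- The charts of the mapping torus are local inverses of the projection from `ℝ × M`, followed by
charts of `ℝ × M`. -/
instance : ChartedSpace (ModelProd ℝ H) (MappingTorus g) :=
  inferInstanceAs (ChartedSpace (ModelProd ℝ H)
    (MulAction.orbitRel.Quotient (Multiplicative ℤ) (MappingTorusCover g)))

instance [IsManifold I ∞ M] : IsManifold (𝓘(ℝ, ℝ).prod I) ∞ (MappingTorus g) :=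
  isManifold_orbitRel_quotient (𝓘(ℝ, ℝ).prod I) ∞ (MappingTorusCover.contMDiff_smul_cover g)

end MappingTorus

end MappingTorus

/-! ## Symplectic forms -/

section Symplectic

variable {E : Type*} [NormedAddCommGroup E] [NormedSpace ℝ E] {H : Type*} [TopologicalSpace H]
  (I : ModelWithCorners ℝ E H)

/-- Fields of alternating bilinear forms on the tangent spaces of `N` (no regularity). -/
abbrev TwoForm (N : Type*) [TopologicalSpace N] [ChartedSpace H N] : Type _ :=
  ∀ x : N, TangentSpace I x [⋀^Fin 2]→L[ℝ] ℝ

variable {N : Type*} [TopologicalSpace N] [ChartedSpace H N]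

/-- The coordinate expression of a two-form in the preferred chart at `x₀`, i.e. its pullback under
the inverse of the chart. -/
def TwoForm.inChart (η : TwoForm I N) (x₀ : N) (y : E) : E [⋀^Fin 2]→L[ℝ] ℝ :=
  (η ((extChartAt I x₀).symm y)).compContinuousLinearMap
    (mfderivWithin 𝓘(ℝ, E) I (extChartAt I x₀).symm (range I) y)

/-- A symplectic form: a smooth, closed, nondegenerate two-form. -/
structure IsSymplecticForm (η : TwoForm I N) : Prop where
  smooth : ∀ x₀ : N, ContDiffOn ℝ ∞ (TwoForm.inChart I η x₀) (extChartAt I x₀).target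
  closed : ∀ x₀ : N, ∀ y ∈ (extChartAt I x₀).target,
    extDerivWithin (TwoForm.inChart I η x₀) (range I) y = 0
  nondegenerate : ∀ (x : N) (v : TangentSpace I x),
    (∀ w : TangentSpace I x, η x ![v, w] = 0) → v = 0

/-- The map `f` preserves the two-form `η`, i.e. `f^* η = η`. -/
def PreservesForm (η : TwoForm I N) (f : N → N) : Prop :=
  ∀ x : N, (η (f x)).compContinuousLinearMap (mfderiv I I f x) = η x

/-- Two diffeomorphisms are (smoothly) isotopic: they are joined by a smooth family of
diffeomorphisms parametrized by `[0, 1]`. -/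
def AreIsotopic {I : ModelWithCorners ℝ E H} (f₀ f₁ : N ≃ₘ⟮I, I⟯ N) : Prop :=
  ∃ Φ : ℝ → (N ≃ₘ⟮I, I⟯ N), Φ 0 = f₀ ∧ Φ 1 = f₁ ∧
    ContMDiffOn (𝓘(ℝ, ℝ).prod I) I ∞ (fun p : ℝ × N => Φ p.1 p.2) (Icc (0 : ℝ) 1 ×ˢ univ)

/-- A transformation in a group acting by smooth maps, as a diffeomorphism. -/
def smulDiffeomorph {I : ModelWithCorners ℝ E H} {G : Type*} [Group G] [MulAction G N]
    (hG : ∀ a : G, ContMDiff I I ∞ (fun x : N => a • x)) (a : G) : N ≃ₘ⟮I, I⟯ N where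
  toEquiv := MulAction.toPerm a
  contMDiff_toFun := hG a
  contMDiff_invFun := hG a⁻¹

end Symplectic

/-! ## Subsets of manifolds -/

section Subsets

variable {E : Type*} [NormedAddCommGroup E] [NormedSpace ℝ E] {H : Type*} [TopologicalSpace H]
  (I : ModelWithCorners ℝ E H)
  {E' : Type*} [NormedAddCommGroup E'] [NormedSpace ℝ E'] {H' : Type*} [TopologicalSpace H']
  (J : ModelWithCorners ℝ E' H')

/-- A map from a subset `A` of a manifold to a manifold is smooth if near every point of `A` it
extends to a smooth map on an open set of the ambient manifold. -/
def SmoothOnSubset {N : Type*} [TopologicalSpace N] [ChartedSpace H N]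
    {N' : Type*} [TopologicalSpace N'] [ChartedSpace H' N'] {A : Set N} (f : A → N') : Prop :=
  ∀ a : A, ∃ U : Set N, IsOpen U ∧ (a : N) ∈ U ∧
    ∃ F : N → N', ContMDiffOn I J ∞ F U ∧ ∀ b : A, (b : N) ∈ U → F b = f b

/-- Two subsets of manifolds are diffeomorphic: there is a bijection between them that is smooth in
both directions. For embedded submanifolds, also with components of different dimensions, this is
diffeomorphism in the usual sense. -/
def AreDiffeomorphicSubsets {N : Type*} [TopologicalSpace N] [ChartedSpace H N]
    {N' : Type*} [TopologicalSpace N'] [ChartedSpace H' N'] (A : Set N) (B : Set N') : Prop :=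
  ∃ e : A ≃ B, SmoothOnSubset I J (fun a : A => (e a : N')) ∧
    SmoothOnSubset J I (fun b : B => (e.symm b : N))

/-- A subset `S` of a manifold `N` is, with the smooth structure induced from `N`, a symplectic
manifold (whose components may have different dimensions): every connected component of `S` is open
in `S` and is the image of a smooth embedding of a symplectic manifold. The symplectic forms on the
components are arbitrary, not related to a form on `N`. -/
def IsSymplecticSubset {N : Type u} [TopologicalSpace N] [ChartedSpace H N] (S : Set N) : Prop :=
  ∀ x ∈ S,
    (∃ U : Set N, IsOpen U ∧ S ∩ U = connectedComponentIn S x) ∧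
    ∃ (d : ℕ) (P : Type u) (_ : TopologicalSpace P) (_ : ChartedSpace (EuclideanSpace ℝ (Fin d)) P)
      (_ : IsManifold (𝓡 d) ∞ P) (ι : P → N) (σ : TwoForm (𝓡 d) P),
      Manifold.IsSmoothEmbedding (𝓡 d) I ∞ ι ∧ range ι = connectedComponentIn S x ∧
        IsSymplecticForm (𝓡 d) σ

end Subsets

/-- The cyclic subgroup `ℤ_r` of the circle group: the `r`-th roots of unity. -/
def circleCyclicSubgroup (r : ℕ) : Subgroup Circle := (powMonoidHom r : Circle →* Circle).ker

end

/-! Everything is done on the common cover `ℝ × (ℝ × M)`, with points `(s, t, x)`, of `S¹ × T(g)`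
and of `S¹ × S¹ × M`. Forms go up by pullback, and come down by `TwoForm.exists_pullback_eq` when
deck transformations preserve them.

Symplectic form: let `g` be isotopic to the symplectomorphism `f`. The isotopy, made constant near
its ends, is glued into a smooth family `ψ t` of diffeomorphisms of `M` that intertwines the deck
transformations of `g` with those of `f` (`AreIsotopic.exists_equivariant_family`). As `f` preserves
`η`, the form `ds ∧ dt + ψ^* η` is invariant under the deck group of `S¹ × T(g)` and descends.

Action: since `g ^ r = 1`, the suspension flow `[t, x] ↦ [t + u, x]` has period `r`. Let `exp
(2πiu)` act as the flow for time `r u`. It fixes `[s, t, x]` exactly when `r u` is an integer `n`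
with `gⁿ x = x`. So no point is fixed by the whole circle, and the isotropy group is `ℤ_r` exactly
when `g x = x`. Over such points the deck transformations of `S¹ × T(g)` and of `S¹ × S¹ × M` are
the same integer translations, which identifies the isotropy set with `S¹ × S¹ × F`.

Obstruction: an invariant symplectic form, lifted to the cover, is preserved by all maps that lift
elements of the circle. Integer translations in `t` are among them, so the lift descends to a
symplectic form on `S¹ × S¹ × M`; so is `id × id × g`, which lifts `exp (2πi/r)`. Thus `S¹ × S¹ × F`
is the fixed point set of a symplectic map of finite order, and `isSymplecticSubset_fixedPoints`
makes it symplectic. That lemma rests on linearization by averaging (`exists_linearizing_chart`) and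
on the same averaging in each tangent space (`eq_zero_of_twoForm_fixed`). -/

noncomputable section

/-! ### Smooth closed two-forms on normed spaces. -/

section LocalForms

variable {E : Type*} [NormedAddCommGroup E] [NormedSpace ℝ E]
  {E' : Type*} [NormedAddCommGroup E'] [NormedSpace ℝ E']

/-- A two-form on a normed space is smooth at `y` and closed near `y`. -/
def SmoothClosedAt (α : E → E [⋀^Fin 2]→L[ℝ] ℝ) (y : E) : Prop :=
  ContDiffAt ℝ ∞ α y ∧ ∀ᶠ z in 𝓝 y, extDeriv α z = 0

theorem SmoothClosedAt.congr {α β : E → E [⋀^Fin 2]→L[ℝ] ℝ} {y : E} (h : SmoothClosedAt α y)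
    (h' : β =ᶠ[𝓝 y] α) : SmoothClosedAt β y := by
  refine ⟨h.1.congr_of_eventuallyEq h', ?_⟩
  filter_upwards [h.2, h'.extDeriv] with z hz hz'
  rw [hz', hz]

theorem SmoothClosedAt.add {α β : E → E [⋀^Fin 2]→L[ℝ] ℝ} {y : E} (h : SmoothClosedAt α y)
    (h' : SmoothClosedAt β y) : SmoothClosedAt (fun z => α z + β z) y := by
  refine ⟨h.1.add h'.1, ?_⟩
  -- Smoothness of order `∞` at a point provides a neighbourhood for each finite order only, so
  -- order one is extracted before passing to nearby points.
  filter_upwards [h.2, h'.2, (h.1.of_le (m := 1) (by simp)).eventually (by simp),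
    (h'.1.of_le (m := 1) (by simp)).eventually (by simp)]
    with z hz hz' hd hd'
  rw [extDeriv_fun_add (hd.differentiableAt (by simp)) (hd'.differentiableAt (by simp)), hz, hz',
    add_zero]

theorem smoothClosedAt_const (c : E [⋀^Fin 2]→L[ℝ] ℝ) (y : E) :
    SmoothClosedAt (fun _ => c) y := by
  refine ⟨contDiffAt_const, Filter.Eventually.of_forall fun z => ?_⟩
  ext v
  rw [extDeriv_apply (differentiableAt_const _)]
  simp

/-- A linear left inverse of `T` is continuous because it starts from the finite-dimensional `W`.
Nothing is needed about the topology of `F`, which will be a space of forms. -/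
theorem contDiffAt_of_injective_comp {F W : Type*} [NormedAddCommGroup F] [NormedSpace ℝ F]
    [NormedAddCommGroup W] [NormedSpace ℝ W] [FiniteDimensional ℝ W] (T : F →ₗ[ℝ] W)
    (hT : Function.Injective T) {n : WithTop ℕ∞} {f : E → F} {y : E}
    (h : ContDiffAt ℝ n (fun z => T (f z)) y) : ContDiffAt ℝ n f y := by
  obtain ⟨S, hS⟩ := T.exists_leftInverse_of_injective (LinearMap.ker_eq_bot.2 hT)
  have h1 := S.toContinuousLinearMap.contDiff.contDiffAt.comp y h
  refine h1.congr_of_eventuallyEq (Filter.Eventually.of_forall fun z => ?_)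
  exact (LinearMap.congr_fun hS (f z)).symm

/-- Finitely many values on pairs of basis vectors determine a form, so evaluation on them is an
injective map to which the preceding lemma applies. -/
theorem contDiffAt_twoForm [FiniteDimensional ℝ E] {n : WithTop ℕ∞}
    {α : E' → E [⋀^Fin 2]→L[ℝ] ℝ} {y : E'}
    (h : ∀ v w : E, ContDiffAt ℝ n (fun z => α z ![v, w]) y) : ContDiffAt ℝ n α y := by
  let b := Module.finBasis ℝ E
  let T : (E [⋀^Fin 2]→L[ℝ] ℝ) →ₗ[ℝ]
      (Fin (Module.finrank ℝ E) × Fin (Module.finrank ℝ E) → ℝ) :=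
    { toFun := fun a ij => a ![b ij.1, b ij.2]
      map_add' := fun a a' => by ext; simp
      map_smul' := fun c a => by ext; simp }
  refine contDiffAt_of_injective_comp T ?_ (contDiffAt_pi.2 fun ij => h _ _)
  intro a a' haa
  have : a.toMultilinearMap = a'.toMultilinearMap := by
    refine Module.Basis.ext_multilinear (fun _ => b) fun v => ?_
    have := congrFun haa (v 0, v 1)
    have hv : (fun i => b (v i)) = ![b (v 0), b (v 1)] := by
      ext i; fin_cases i <;> rfl
    rw [hv]; exact this
  ext v
  exact congrArg (fun q => q v) this

/-- Currying is bounded linear, so evaluation on two varying vectors reduces to two applications of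
linear maps depending smoothly on the point. -/
theorem ContDiffAt.twoForm_apply {n : WithTop ℕ∞} {α : E' → E [⋀^Fin 2]→L[ℝ] ℝ}
    {v w : E' → E} {y : E'} (h : ContDiffAt ℝ n α y) (hv : ContDiffAt ℝ n v y)
    (hw : ContDiffAt ℝ n w y) : ContDiffAt ℝ n (fun z => α z ![v z, w z]) y := by
  have b1 : IsBoundedLinearMap ℝ (fun a : E [⋀^Fin 2]→L[ℝ] ℝ => a.curryLeft) :=
    ⟨⟨ContinuousAlternatingMap.curryLeft_add, ContinuousAlternatingMap.curryLeft_smul⟩, 1,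
      by norm_num, fun a => by simp [ContinuousAlternatingMap.norm_curryLeft]⟩
  have b2 : IsBoundedLinearMap ℝ (fun a : E [⋀^Fin 1]→L[ℝ] ℝ => a.curryLeft) :=
    ⟨⟨ContinuousAlternatingMap.curryLeft_add, ContinuousAlternatingMap.curryLeft_smul⟩, 1,
      by norm_num, fun a => by simp [ContinuousAlternatingMap.norm_curryLeft]⟩
  have c1 : ContDiff ℝ n (fun a : E [⋀^Fin 2]→L[ℝ] ℝ => a.curryLeft) := b1.contDiff
  have c2 : ContDiff ℝ n (fun a : E [⋀^Fin 1]→L[ℝ] ℝ => a.curryLeft) := b2.contDiff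
  have h1 : ContDiffAt ℝ n (fun z => (α z).curryLeft) y := c1.contDiffAt.comp y h
  have h2 : ContDiffAt ℝ n (fun z => ((α z).curryLeft (v z)).curryLeft) y :=
    c2.contDiffAt.comp y (h1.clm_apply hv)
  have h3 := h2.clm_apply hw
  refine (((ContinuousAlternatingMap.constOfIsEmptyLIE ℝ E ℝ (Fin 0)).symm.contDiff.contDiffAt.comp
    y h3)).congr_of_eventuallyEq (Filter.Eventually.of_forall fun z => ?_)
  change _ = α z (Matrix.vecCons (v z) (Matrix.vecCons (w z) 0))
  exact congrArg (α z) (by ext i; fin_cases i <;> rfl)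

theorem SmoothClosedAt.pullback [FiniteDimensional ℝ E] {α : E' → E' [⋀^Fin 2]→L[ℝ] ℝ}
    {f : E → E'} {y : E} (h : SmoothClosedAt α (f y)) (hf : ContDiffAt ℝ ∞ f y) :
    SmoothClosedAt (fun z => (α (f z)).compContinuousLinearMap (fderiv ℝ f z)) y := by
  constructor
  · have h1 : ContDiffAt ℝ ∞ (fun z => α (f z)) y := h.1.comp y hf
    have h2 : ContDiffAt ℝ ∞ (fderiv ℝ f) y := hf.fderiv_right (by simp)
    refine contDiffAt_twoForm fun v w => ?_
    have h3 := h1.twoForm_apply (h2.clm_apply (contDiffAt_const (c := v)))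
      (h2.clm_apply (contDiffAt_const (c := w)))
    refine h3.congr_of_eventuallyEq (Filter.Eventually.of_forall fun z => ?_)
    simp only [ContinuousAlternatingMap.compContinuousLinearMap_apply]
    congr 1
    ext i; fin_cases i <;> rfl
  · have hev : ∀ᶠ z in 𝓝 y, extDeriv α (f z) = 0 := hf.continuousAt.eventually h.2
    have hev' : ∀ᶠ z in 𝓝 y, ContDiffAt ℝ 1 α (f z) :=
      hf.continuousAt.eventually ((h.1.of_le (m := 1) (by simp)).eventually (by simp))
    -- Two derivatives of `f` are required: `d (f^* α) = f^* (dα)` uses the symmetry of its second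
    -- derivative.
    filter_upwards [hev, hev', (hf.of_le (m := 2) (WithTop.coe_le_coe.2 le_top)).eventually (by simp)]
      with z hz hz' hfz
    rw [extDeriv_pullback (r := 2) (hz'.differentiableAt (by simp)) hfz
      (by simp), hz]
    ext v; simp

end LocalForms

/-! ### Pullback of two-forms, and their descent along local diffeomorphisms. -/

section ManifoldForms

variable {E : Type*} [NormedAddCommGroup E] [NormedSpace ℝ E] {H : Type*} [TopologicalSpace H]
  {I : ModelWithCorners ℝ E H} {X : Type*} [TopologicalSpace X] [ChartedSpace H X]
  {E' : Type*} [NormedAddCommGroup E'] [NormedSpace ℝ E'] {H' : Type*} [TopologicalSpace H']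
  {J : ModelWithCorners ℝ E' H'} {N : Type*} [TopologicalSpace N] [ChartedSpace H' N]
  {E'' : Type*} [NormedAddCommGroup E''] [NormedSpace ℝ E''] {H'' : Type*} [TopologicalSpace H'']
  {K : ModelWithCorners ℝ E'' H''} {P : Type*} [TopologicalSpace P] [ChartedSpace H'' P]

variable (I J) in
/-- The pullback of a two-form under a map. -/
def TwoForm.pullback (f : X → N) (η : TwoForm J N) : TwoForm I X :=
  fun x => (η (f x)).compContinuousLinearMap (mfderiv I J f x)

theorem TwoForm.pullback_apply (f : X → N) (η : TwoForm J N) (x : X) (v w : TangentSpace I x) :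
    TwoForm.pullback I J f η x ![v, w] = η (f x) ![mfderiv I J f x v, mfderiv I J f x w] := by
  change η (f x) (mfderiv I J f x ∘ ![v, w]) = _
  congr 1
  ext i; fin_cases i <;> rfl

theorem TwoForm.ext_apply {η η' : TwoForm I X} {x : X}
    (h : ∀ v w : TangentSpace I x, η x ![v, w] = η' x ![v, w]) : η x = η' x := by
  ext v
  have := h (v 0) (v 1)
  have hv : ![v 0, v 1] = v := by ext i; fin_cases i <;> rfl
  rwa [hv] at this

theorem preservesForm_iff {η : TwoForm I X} {f : X → X} :
    PreservesForm I η f ↔ TwoForm.pullback I I f η = η :=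
  funext_iff.symm

theorem TwoForm.pullback_comp {f : X → N} {g : N → P} (η : TwoForm K P) {x : X}
    (hg : MDifferentiableAt J K g (f x)) (hf : MDifferentiableAt I J f x) :
    TwoForm.pullback I K (g ∘ f) η x = TwoForm.pullback I J f (TwoForm.pullback J K g η) x := by
  refine TwoForm.ext_apply fun v w => ?_
  simp only [TwoForm.pullback_apply]
  rw [mfderiv_comp x hg hf]
  rfl

theorem TwoForm.pullback_congr {f g : X → N} (η : TwoForm J N) {x : X} (h : f =ᶠ[𝓝 x] g) :
    ∀ᶠ y in 𝓝 x, TwoForm.pullback I J f η y = TwoForm.pullback I J g η y := by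
  filter_upwards [h.eventuallyEq_nhds] with y hy
  refine TwoForm.ext_apply fun v w => ?_
  simp only [TwoForm.pullback_apply]
  rw [hy.mfderiv_eq, hy.self_of_nhds]

variable (I) in
/-- A two-form is smooth and closed, in the preferred charts. -/
def IsSmoothClosedForm (η : TwoForm I X) : Prop :=
  ∀ x₀ : X, ∀ y ∈ (extChartAt I x₀).target, SmoothClosedAt (TwoForm.inChart I η x₀) y

theorem TwoForm.inChart_eq_pullback [I.Boundaryless] (η : TwoForm I X) (x₀ : X) :
    TwoForm.inChart I η x₀ = TwoForm.pullback 𝓘(ℝ, E) I (extChartAt I x₀).symm η := by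
  funext y
  simp only [TwoForm.inChart, TwoForm.pullback, I.range_eq_univ, mfderivWithin_univ]
  rfl

/-- Without boundary the range of the model is everything and chart targets are open, so derivatives
within a set become ordinary ones. -/
theorem isSymplecticForm_iff [I.Boundaryless] {η : TwoForm I X} :
    IsSymplecticForm I η ↔ IsSmoothClosedForm I η ∧ ∀ (x : X) (v : TangentSpace I x),
      (∀ w : TangentSpace I x, η x ![v, w] = 0) → v = 0 := by
  constructor
  · intro h
    refine ⟨fun x₀ y hy => ⟨(h.smooth x₀).contDiffAt
      ((isOpen_extChartAt_target x₀).mem_nhds hy), ?_⟩, h.nondegenerate⟩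
    filter_upwards [(isOpen_extChartAt_target x₀).mem_nhds hy] with z hz
    have := h.closed x₀ z hz
    rwa [I.range_eq_univ, extDerivWithin_univ] at this
  · rintro ⟨h, h'⟩
    refine ⟨fun x₀ y hy => (h x₀ y hy).1.contDiffWithinAt, fun x₀ y hy => ?_, h'⟩
    rw [I.range_eq_univ, extDerivWithin_univ]
    exact (h x₀ y hy).2.self_of_nhds

/-- The pullback of a smooth closed form under a parametrization by a vector space. -/
theorem IsSmoothClosedForm.smoothClosedAt_pullback [FiniteDimensional ℝ E] [J.Boundaryless]
    [IsManifold J ∞ N] {η : TwoForm J N} (h : IsSmoothClosedForm J η) {f : E → N} {y : E}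
    (hf : ContMDiffAt 𝓘(ℝ, E) J ∞ f y) :
    SmoothClosedAt (TwoForm.pullback 𝓘(ℝ, E) J f η) y := by
  have hs : ∀ᶠ z in 𝓝 y, f z ∈ (extChartAt J (f y)).source :=
    hf.continuousAt (extChartAt_source_mem_nhds (f y))
  have hc : ContDiffAt ℝ ∞ (extChartAt J (f y) ∘ f) y :=
    (contMDiffAt_extChartAt.comp y hf).contDiffAt
  have hp := (h (f y) (extChartAt J (f y) (f y)) (mem_extChartAt_target _)).pullback
    (f := extChartAt J (f y) ∘ f) hc
  refine hp.congr ?_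
  filter_upwards [hs, hs.eventually_nhds,
    (hc.of_le (m := 1) (by simp)).eventually (by simp)] with z hz hzz hcz
  -- Factoring `f` through the chart at `f y` turns the pullback of `η` into the pullback of its
  -- coordinate expression, which is the vector space case.
  have e1 : f =ᶠ[𝓝 z] (extChartAt J (f y)).symm ∘ (extChartAt J (f y) ∘ f) := by
    filter_upwards [hzz] with z' hz'
    exact ((extChartAt J (f y)).left_inv hz').symm
  have m1 : MDifferentiableAt 𝓘(ℝ, E') J (extChartAt J (f y)).symm
      ((extChartAt J (f y) ∘ f) z) :=
    ((contMDiffOn_extChartAt_symm (n := ∞) (f y)).contMDiffAt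
      ((isOpen_extChartAt_target _).mem_nhds
        ((extChartAt J (f y)).map_source hz))).mdifferentiableAt (by simp)
  have m2 : MDifferentiableAt 𝓘(ℝ, E) 𝓘(ℝ, E') (extChartAt J (f y) ∘ f) z :=
    (hcz.differentiableAt (by simp)).mdifferentiableAt
  rw [(TwoForm.pullback_congr η e1).self_of_nhds, TwoForm.pullback_comp η m1 m2,
    TwoForm.inChart_eq_pullback, ← mfderiv_eq_fderiv]
  rfl

/-- The pullback of a smooth closed form under a smooth map is smooth and closed. -/
theorem IsSmoothClosedForm.pullback [FiniteDimensional ℝ E] [I.Boundaryless] [IsManifold I ∞ X]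
    [J.Boundaryless] [IsManifold J ∞ N] {η : TwoForm J N} (h : IsSmoothClosedForm J η) {f : X → N}
    (hf : ContMDiff I J ∞ f) : IsSmoothClosedForm I (TwoForm.pullback I J f η) := by
  intro x₀ y hy
  have hs : ∀ z ∈ (extChartAt I x₀).target, ContMDiffAt 𝓘(ℝ, E) I ∞ (extChartAt I x₀).symm z :=
    fun z hz => (contMDiffOn_extChartAt_symm (n := ∞) x₀).contMDiffAt
      ((isOpen_extChartAt_target _).mem_nhds hz)
  refine (h.smoothClosedAt_pullback (hf.contMDiffAt.comp y (hs y hy))).congr ?_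
  filter_upwards [(isOpen_extChartAt_target x₀).mem_nhds hy] with z hz
  rw [TwoForm.pullback_comp η (hf.mdifferentiableAt (by simp))
    ((hs z hz).mdifferentiableAt (by simp)), TwoForm.inChart_eq_pullback]

theorem IsSmoothClosedForm.add {η η' : TwoForm I X} (h : IsSmoothClosedForm I η)
    (h' : IsSmoothClosedForm I η') : IsSmoothClosedForm I (fun x => η x + η' x) :=
  fun x₀ y hy => ((h x₀ y hy).add (h' x₀ y hy)).congr (Filter.Eventually.of_forall fun _ => rfl)

theorem isSmoothClosedForm_const (c : E [⋀^Fin 2]→L[ℝ] ℝ) :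
    IsSmoothClosedForm 𝓘(ℝ, E) (fun _ => c : TwoForm 𝓘(ℝ, E) E) := by
  intro x₀ y _
  refine (smoothClosedAt_const c y).congr (Filter.Eventually.of_forall fun z => ?_)
  refine (congrFun (TwoForm.inChart_eq_pullback _ x₀) z).trans ?_
  refine TwoForm.ext_apply (I := 𝓘(ℝ, E)) (η := TwoForm.pullback 𝓘(ℝ, E) 𝓘(ℝ, E) _ _)
    (η' := fun _ => c) fun v w => ?_
  refine (TwoForm.pullback_apply _ _ _ _ _).trans ?_
  have h1 : mfderiv 𝓘(ℝ, E) 𝓘(ℝ, E) (extChartAt 𝓘(ℝ, E) x₀).symm z =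
      ContinuousLinearMap.id ℝ E := by
    have : ((extChartAt 𝓘(ℝ, E) x₀).symm : E → E) = id := by
      simp only [mfld_simps, chartAt_self_eq]
    rw [this]
    exact mfderiv_id
  rw [h1]
  rfl

/-- A local diffeomorphism has a smooth local right inverse through any given point. -/
theorem IsLocalDiffeomorphAt.exists_section {f : X → N} {x : X}
    (h : IsLocalDiffeomorphAt I J ∞ f x) : ∃ (s : N → X) (U : Set N), IsOpen U ∧ f x ∈ U ∧
      ContMDiffOn J I ∞ s U ∧ s (f x) = x ∧ ∀ y ∈ U, f (s y) = y :=
  ⟨h.localInverse, h.localInverse.source, h.localInverse_open_source, h.localInverse_mem_source,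
    h.contmdiffOn_localInverse, h.localInverse_left_inv h.localInverse_mem_target,
    fun _ hy => h.localInverse_right_inv hy⟩

/-- Smoothness and closedness descend along surjective local diffeomorphisms. -/
theorem IsSmoothClosedForm.of_pullback [FiniteDimensional ℝ E'] [I.Boundaryless]
    [IsManifold I ∞ X] [J.Boundaryless] [IsManifold J ∞ N] {η : TwoForm J N} {f : X → N}
    (hf : IsLocalDiffeomorph I J ∞ f) (hsurj : Function.Surjective f)
    (h : IsSmoothClosedForm I (TwoForm.pullback I J f η)) : IsSmoothClosedForm J η := by
  intro x₀ y hy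
  have hc : ∀ z ∈ (extChartAt J x₀).target, ContMDiffAt 𝓘(ℝ, E') J ∞ (extChartAt J x₀).symm z :=
    fun z hz => (contMDiffOn_extChartAt_symm (n := ∞) x₀).contMDiffAt
      ((isOpen_extChartAt_target _).mem_nhds hz)
  obtain ⟨q, hq⟩ := hsurj ((extChartAt J x₀).symm y)
  obtain ⟨s, U, hU, hqU, hs, -, hfs⟩ := (hf q).exists_section
  rw [hq] at hqU
  have hsc : ∀ z ∈ (extChartAt J x₀).target, (extChartAt J x₀).symm z ∈ U →
      ContMDiffAt 𝓘(ℝ, E') I ∞ (s ∘ (extChartAt J x₀).symm) z := fun z hz hzU =>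
    (hs.contMDiffAt (hU.mem_nhds hzU)).comp z (hc z hz)
  have hev : ∀ᶠ z in 𝓝 y, (extChartAt J x₀).symm z ∈ U :=
    (hc y hy).continuousAt (hU.mem_nhds hqU)
  refine (h.smoothClosedAt_pullback (hsc y hy hqU)).congr ?_
  filter_upwards [(isOpen_extChartAt_target x₀).mem_nhds hy, hev.eventually_nhds] with z hz hzU
  -- Lifting the inverse chart through a local section of `f` expresses `η` in coordinates by means
  -- of its pullback alone.
  have e1 : (extChartAt J x₀).symm =ᶠ[𝓝 z] f ∘ (s ∘ (extChartAt J x₀).symm) := by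
    filter_upwards [hzU] with z' hz' using (hfs _ hz').symm
  rw [TwoForm.inChart_eq_pullback, (TwoForm.pullback_congr η e1).self_of_nhds,
    TwoForm.pullback_comp η ((hf _).contMDiffAt.mdifferentiableAt (by simp))
      ((hsc z hz hzU.self_of_nhds).mdifferentiableAt (by simp))]

theorem IsLocalDiffeomorph.bijective_mfderiv {f : X → N} (hf : IsLocalDiffeomorph I J ∞ f) (x : X) :
    Function.Bijective (mfderiv I J f x) := by
  have h := (hf x).mfderivToContinuousLinearEquiv_coe (by simp)
  rw [← h]
  exact ((hf x).mfderivToContinuousLinearEquiv (by simp)).bijective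

/-- A symplectic form pulls back to a symplectic form under a local diffeomorphism. -/
theorem IsSymplecticForm.pullback [FiniteDimensional ℝ E] [I.Boundaryless] [IsManifold I ∞ X]
    [J.Boundaryless] [IsManifold J ∞ N] {η : TwoForm J N} (h : IsSymplecticForm J η) {f : X → N}
    (hf : IsLocalDiffeomorph I J ∞ f) : IsSymplecticForm I (TwoForm.pullback I J f η) := by
  rw [isSymplecticForm_iff] at h ⊢
  refine ⟨h.1.pullback hf.contMDiff, fun x v hv => ?_⟩
  have hb := hf.bijective_mfderiv x
  refine hb.1 ?_
  rw [map_zero]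
  refine h.2 _ _ fun w => ?_
  obtain ⟨w, rfl⟩ := hb.2 w
  rw [← TwoForm.pullback_apply]
  exact hv w

/-- A form is determined by its pullback under a surjective local diffeomorphism. -/
theorem TwoForm.pullback_injective {f : X → N} (hf : IsLocalDiffeomorph I J ∞ f)
    (hsurj : Function.Surjective f) : Function.Injective (TwoForm.pullback I J f) := by
  intro η η' h
  funext y
  obtain ⟨x, rfl⟩ := hsurj y
  refine TwoForm.ext_apply fun v w => ?_
  obtain ⟨v, rfl⟩ := (hf.bijective_mfderiv x).2 v
  obtain ⟨w, rfl⟩ := (hf.bijective_mfderiv x).2 w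
  rw [← TwoForm.pullback_apply, ← TwoForm.pullback_apply, h]

/-- Descent of forms: a form on the source of a surjective local diffeomorphism `f` is a pullback,
provided that points with the same image are connected by deck transformations preserving it. -/
theorem TwoForm.exists_pullback_eq {f : X → N} (hf : IsLocalDiffeomorph I J ∞ f)
    (hsurj : Function.Surjective f) (η : TwoForm I X)
    (hdeck : ∀ x x', f x = f x' → ∃ D : X → X, MDifferentiable I I D ∧ D x = x' ∧ f ∘ D = f ∧
      TwoForm.pullback I I D η = η) :
    ∃ σ : TwoForm J N, TwoForm.pullback I J f σ = η := by
  choose q hq using hsurj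
  let L : ∀ x, TangentSpace I x ≃L[ℝ] TangentSpace J (f x) := fun x =>
    (hf x).mfderivToContinuousLinearEquiv (by simp)
  have hL : ∀ x v, L x v = mfderiv I J f x v := fun x v => by
    rw [← (hf x).mfderivToContinuousLinearEquiv_coe (by simp)]; rfl
  -- The value at `y` is transported from one chosen preimage. Tangent spaces at `f (q y)` and at
  -- `y` are both the model space, so a type ascription identifies them.
  let σ : TwoForm J N := fun y => (η (q y)).compContinuousLinearMap
    (((L (q y)).symm : TangentSpace J (f (q y)) →L[ℝ] TangentSpace I (q y)) :
      TangentSpace J y →L[ℝ] TangentSpace I (q y))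
  have hσ : ∀ y (v w : TangentSpace J y), σ y ![v, w] =
      η (q y) ![(L (q y)).symm v, (L (q y)).symm w] := by
    intro y v w
    change η (q y) ((L (q y)).symm ∘ ![v, w]) = _
    congr 1
    ext i; fin_cases i <;> rfl
  refine ⟨σ, ?_⟩
  funext x
  refine TwoForm.ext_apply fun v w => ?_
  rw [TwoForm.pullback_apply, hσ]
  obtain ⟨D, hD, hDx, hfD, hDη⟩ := hdeck x (q (f x)) (hq _).symm
  -- The chain rule for `f ∘ D = f`: moving a vector from `x` to `x'` through `N` is the derivative
  -- of the deck transformation.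
  have key : ∀ x', D x = x' → ∀ v : TangentSpace I x,
      (L x').symm (mfderiv I J f x v) = mfderiv I I D x v := by
    rintro _ rfl v
    have h1 := mfderiv_comp_apply x ((hf (D x)).contMDiffAt.mdifferentiableAt (by simp)) (hD x) v
    rw [hfD, ← hL] at h1
    exact (congrArg (L (D x)).symm h1).trans ((L (D x)).symm_apply_apply _)
  rw [key _ hDx, key _ hDx, ← hDx]
  have h2 := congrArg (fun a => a ![v, w]) (congrFun hDη x)
  simp only [TwoForm.pullback_apply] at h2
  exact h2

theorem IsSymplecticForm.of_pullback [FiniteDimensional ℝ E'] [I.Boundaryless]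
    [IsManifold I ∞ X] [J.Boundaryless] [IsManifold J ∞ N] {η : TwoForm J N} {f : X → N}
    (hf : IsLocalDiffeomorph I J ∞ f) (hsurj : Function.Surjective f)
    (h : IsSymplecticForm I (TwoForm.pullback I J f η)) : IsSymplecticForm J η := by
  rw [isSymplecticForm_iff] at h ⊢
  refine ⟨h.1.of_pullback hf hsurj, fun y v hv => ?_⟩
  obtain ⟨x, rfl⟩ := hsurj y
  obtain ⟨v, rfl⟩ := (hf.bijective_mfderiv x).2 v
  rw [h.2 x v fun w => by rw [TwoForm.pullback_apply]; exact hv _, map_zero]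

end ManifoldForms

/-! ### Submanifolds given by slice charts, and immersions. -/

section Submanifold

variable {E : Type*} [NormedAddCommGroup E] [NormedSpace ℝ E] {H : Type*} [TopologicalSpace H]
  (I : ModelWithCorners ℝ E H) {N : Type*} [TopologicalSpace N] [ChartedSpace H N]
  {V : Type*} [NormedAddCommGroup V] [NormedSpace ℝ V]
  {F : Type*} [NormedAddCommGroup F] [NormedSpace ℝ F]

variable (V F) in
/-- A chart of `N` with values in `V × F` in which the subset `C` is the slice `V × {0}`. -/
structure SliceChart (C : Set N) (x : N) where
  toChart : OpenPartialHomeomorph N (V × F)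
  mem_source : x ∈ toChart.source
  contMDiffOn : ContMDiffOn I 𝓘(ℝ, V × F) ∞ toChart toChart.source
  contMDiffOn_symm : ContMDiffOn 𝓘(ℝ, V × F) I ∞ toChart.symm toChart.target
  mem_iff : ∀ p ∈ toChart.source, p ∈ C ↔ (toChart p).2 = 0

namespace SliceChart

variable {I} {C : Set N} {x : N}

/-- The chart of a subset induced by a slice chart. -/
def subtypeChart (Φ : SliceChart I V F C x) (hx : x ∈ C) : OpenPartialHomeomorph C V := by
  classical
  have hmem : ∀ v : V, (v, (0 : F)) ∈ Φ.toChart.target → Φ.toChart.symm (v, 0) ∈ C := by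
    intro v hv
    rw [Φ.mem_iff _ (Φ.toChart.map_target hv), Φ.toChart.right_inv hv]
  exact
  { toFun := fun p => (Φ.toChart p).1
    -- The base point is a default value, never taken on the target.
    invFun := fun v => if h : Φ.toChart.symm (v, 0) ∈ C then ⟨_, h⟩ else ⟨x, hx⟩
    source := {p | (p : N) ∈ Φ.toChart.source}
    target := {v | (v, (0 : F)) ∈ Φ.toChart.target}
    map_source' := by
      intro p hp
      have h0 : (Φ.toChart p).2 = 0 := (Φ.mem_iff _ hp).1 p.2
      have h1 : ((Φ.toChart p).1, (0 : F)) = Φ.toChart p := by rw [← h0]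
      simp only [mem_ofPred_eq] at hp ⊢
      rw [h1]
      exact Φ.toChart.map_source hp
    map_target' := by
      intro v hv
      simp only [mem_ofPred_eq] at hv ⊢
      rw [dif_pos (hmem v hv)]
      exact Φ.toChart.map_target hv
    left_inv' := by
      intro p hp
      have h0 : (Φ.toChart p).2 = 0 := (Φ.mem_iff _ hp).1 p.2
      have h1 : ((Φ.toChart p).1, (0 : F)) = Φ.toChart p := by rw [← h0]
      have h2 : Φ.toChart.symm ((Φ.toChart p).1, 0) = p := by
        rw [h1, Φ.toChart.left_inv hp]
      have h3 : Φ.toChart.symm ((Φ.toChart p).1, 0) ∈ C := by rw [h2]; exact p.2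
      rw [dif_pos h3]
      exact Subtype.ext h2
    right_inv' := by
      intro v hv
      simp only [mem_ofPred_eq] at hv
      rw [dif_pos (hmem v hv), Φ.toChart.right_inv hv]
    open_source := Φ.toChart.open_source.preimage continuous_subtype_val
    open_target := Φ.toChart.open_target.preimage (by fun_prop)
    continuousOn_toFun := continuous_fst.comp_continuousOn
      (Φ.toChart.continuousOn.comp continuous_subtype_val.continuousOn fun _ h => h)
    continuousOn_invFun := by
      rw [Topology.IsEmbedding.subtypeVal.continuousOn_iff]
      have h1 : ContinuousOn (fun v : V => Φ.toChart.symm (v, (0 : F)))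
          {v | (v, (0 : F)) ∈ Φ.toChart.target} :=
        Φ.toChart.continuousOn_symm.comp (by fun_prop) fun _ h => h
      refine h1.congr fun v hv => ?_
      simp only [Function.comp_apply]
      rw [dif_pos (hmem v hv)] }

theorem coe_subtypeChart_symm (Φ : SliceChart I V F C x) (hx : x ∈ C) {v : V}
    (hv : (v, (0 : F)) ∈ Φ.toChart.target) :
    ((Φ.subtypeChart hx).symm v : N) = Φ.toChart.symm (v, 0) := by
  classical
  have h : Φ.toChart.symm (v, 0) ∈ C := by
    rw [Φ.mem_iff _ (Φ.toChart.map_target hv), Φ.toChart.right_inv hv]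
  change ((if h : Φ.toChart.symm (v, 0) ∈ C then (⟨_, h⟩ : C) else ⟨x, hx⟩ : C) : N) = _
  rw [dif_pos h]

/-- The chart of the ambient manifold, with values in the model space, given by a slice chart. -/
def ambientChart [I.Boundaryless] (Φ : SliceChart I V F C x) (θ : (V × F) ≃L[ℝ] E) :
    OpenPartialHomeomorph N H :=
  (Φ.toChart.transHomeomorph θ.toHomeomorph).transHomeomorph I.toHomeomorph.symm

theorem ambientChart_mem_maximalAtlas [I.Boundaryless] [IsManifold I ∞ N]
    (Φ : SliceChart I V F C x) (θ : (V × F) ≃L[ℝ] E) :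
    Φ.ambientChart θ ∈ IsManifold.maximalAtlas I ∞ N := by
  refine OpenPartialHomeomorph.mem_maximalAtlas_of_contMDiffOn (I := I) (n := ∞) _ ?_ ?_
  · have h1 : ContMDiffOn I 𝓘(ℝ, E) ∞ (fun p => θ (Φ.toChart p)) Φ.toChart.source :=
      θ.contDiff.contMDiff.comp_contMDiffOn Φ.contMDiffOn
    have h2 : ContMDiffOn 𝓘(ℝ, E) I ∞ I.symm (range I) := I.contMDiffOn_symm
    exact h2.comp h1 fun p _ => by rw [I.range_eq_univ]; trivial
  · have h1 : ContMDiff I 𝓘(ℝ, V × F) ∞ (fun y : H => θ.symm (I y)) :=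
      θ.symm.contDiff.contMDiff.comp I.contMDiff
    exact Φ.contMDiffOn_symm.comp h1.contMDiffOn fun y hy => hy

end SliceChart

/-- The charted space structure on a subset defined by slice charts. -/
@[reducible] def sliceChartedSpace {C : Set N} (Φ : ∀ x : C, SliceChart I V F C (x : N)) :
    ChartedSpace V C where
  atlas := range fun x : C => (Φ x).subtypeChart x.2
  chartAt x := (Φ x).subtypeChart x.2
  mem_chart_source x := (Φ x).mem_source
  chart_mem_atlas x := mem_range_self x

/-- A transition map is the ambient transition map restricted to `V × {0}`, followed by the
projection to `V`. -/
theorem isManifold_slice {C : Set N} (Φ : ∀ x : C, SliceChart I V F C (x : N)) :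
    @IsManifold ℝ _ V _ _ V _ 𝓘(ℝ, V) ∞ C _ (sliceChartedSpace I Φ) := by
  let := sliceChartedSpace I Φ
  apply isManifold_of_contDiffOn
  rintro _ _ ⟨x, rfl⟩ ⟨y, rfl⟩
  have h1 : ContDiffOn ℝ ∞ (fun v : V => ((Φ y).toChart ((Φ x).toChart.symm (v, (0 : F)))).1)
      {v | (v, (0 : F)) ∈ (Φ x).toChart.target ∧
        (Φ x).toChart.symm (v, (0 : F)) ∈ (Φ y).toChart.source} := by
    have h2 : ContMDiffOn 𝓘(ℝ, V) 𝓘(ℝ, V × F) ∞ (fun v : V => (v, (0 : F)))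
        {v | (v, (0 : F)) ∈ (Φ x).toChart.target ∧
          (Φ x).toChart.symm (v, (0 : F)) ∈ (Φ y).toChart.source} :=
      (ContDiff.contMDiff (by fun_prop)).contMDiffOn
    have h3 := (Φ y).contMDiffOn.comp ((Φ x).contMDiffOn_symm.comp h2 fun v hv => hv.1)
      fun v hv => hv.2
    exact contDiff_fst.comp_contDiffOn h3.contDiffOn
  refine (h1.mono ?_).congr ?_
  · rintro v ⟨⟨hv1, hv2⟩, -⟩
    refine ⟨hv1, ?_⟩
    rw [← (Φ x).coe_subtypeChart_symm x.2 (v := v) hv1]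
    exact hv2
  · rintro v ⟨⟨hv1, hv2⟩, -⟩
    change ((Φ y).toChart (((Φ x).subtypeChart x.2).symm v)).1 = _
    rw [(Φ x).coe_subtypeChart_symm x.2 (v := v) hv1]

/-- In slice charts the inclusion is `v ↦ θ (v, 0)`, which is the normal form in the definition of
an immersion. -/
theorem isSmoothEmbedding_slice [I.Boundaryless] [IsManifold I ∞ N] {C : Set N}
    (θ : (V × F) ≃L[ℝ] E) (Φ : ∀ x : C, SliceChart I V F C (x : N)) :
    letI := sliceChartedSpace I Φ
    Manifold.IsSmoothEmbedding 𝓘(ℝ, V) I ∞ (Subtype.val : C → N) := by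
  let := sliceChartedSpace I Φ
  have := isManifold_slice I Φ
  refine ⟨?_, Topology.IsEmbedding.subtypeVal⟩
  refine Manifold.IsImmersionOfComplement.isImmersion (F := F) fun x => ?_
  refine Manifold.IsImmersionAtOfComplement.mk_of_charts θ (chartAt V x)
    ((Φ x).ambientChart θ) (mem_chart_source V x) (Φ x).mem_source
    (IsManifold.chart_mem_maximalAtlas x) ((Φ x).ambientChart_mem_maximalAtlas θ)
    (fun p hp => hp) ?_
  intro v hv
  have hv1 : (v, (0 : F)) ∈ (Φ x).toChart.target := by
    rw [OpenPartialHomeomorph.extend_target] at hv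
    exact hv.1
  change I (I.symm (θ ((Φ x).toChart (((Φ x).subtypeChart x.2).symm v)))) = θ (v, 0)
  rw [(Φ x).coe_subtypeChart_symm x.2 hv1, (Φ x).toChart.right_inv hv1,
    I.right_inv (by rw [I.range_eq_univ]; trivial)]

/-- The normal form `v ↦ (v, 0)` has the projection as left inverse. Read through the charts it is a
smooth local left inverse `r` of `ι`, and the chain rule applies. -/
theorem Manifold.IsImmersionAt.injective_mfderiv [I.Boundaryless] [IsManifold I ∞ N]
    {P : Type*} [TopologicalSpace P] [ChartedSpace V P] [IsManifold 𝓘(ℝ, V) ∞ P] {ι : P → N} {x : P}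
    (h : Manifold.IsImmersionAt 𝓘(ℝ, V) I ∞ ι x) : Function.Injective (mfderiv 𝓘(ℝ, V) I ι x) := by
  let r : N → P := (h.domChart.extend 𝓘(ℝ, V)).symm ∘ Prod.fst ∘ h.equiv.symm ∘
    h.codChart.extend I
  have hx := h.mem_domChart_source
  have hev : r ∘ ι =ᶠ[𝓝 x] id := by
    filter_upwards [h.domChart.open_source.mem_nhds hx] with p hp
    have hp' : p ∈ (h.domChart.extend 𝓘(ℝ, V)).source := by
      rwa [OpenPartialHomeomorph.extend_source]
    have h1 := h.writtenInCharts ((h.domChart.extend 𝓘(ℝ, V)).map_source hp')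
    simp only [Function.comp_apply, (h.domChart.extend 𝓘(ℝ, V)).left_inv hp'] at h1
    simp only [r, Function.comp_apply, h1, ContinuousLinearEquiv.symm_apply_apply, id]
    exact (h.domChart.extend 𝓘(ℝ, V)).left_inv hp'
  have hι : MDifferentiableAt 𝓘(ℝ, V) I ι x := h.contMDiffAt.mdifferentiableAt (by simp)
  have hr : ContMDiffAt I 𝓘(ℝ, V) ∞ r (ι x) := by
    have c1 : ContMDiffAt I 𝓘(ℝ, E) ∞ (h.codChart.extend I) (ι x) :=
      (h.codChart.contMDiffAt_extend (h.codChart_mem_maximalAtlas) h.mem_codChart_source)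
    have c2 : ContMDiffAt I 𝓘(ℝ, V) ∞ (Prod.fst ∘ h.equiv.symm ∘ h.codChart.extend I) (ι x) :=
      (contDiff_fst.comp h.equiv.symm.contDiff).contMDiff.contMDiffAt.comp (ι x) c1
    have hgx : (Prod.fst ∘ h.equiv.symm ∘ h.codChart.extend I) (ι x) = h.domChart.extend 𝓘(ℝ, V) x := by
      have hp' : x ∈ (h.domChart.extend 𝓘(ℝ, V)).source := by
        rwa [OpenPartialHomeomorph.extend_source]
      have h1 := h.writtenInCharts ((h.domChart.extend 𝓘(ℝ, V)).map_source hp')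
      simp only [Function.comp_apply, (h.domChart.extend 𝓘(ℝ, V)).left_inv hp'] at h1
      simp only [Function.comp_apply, h1, ContinuousLinearEquiv.symm_apply_apply]
    have c3 : ContMDiffAt 𝓘(ℝ, V) 𝓘(ℝ, V) ∞ (h.domChart.extend 𝓘(ℝ, V)).symm
        ((Prod.fst ∘ h.equiv.symm ∘ h.codChart.extend I) (ι x)) := by
      rw [hgx]
      exact contMDiffAt_symm_of_mem_maximalAtlas h.domChart_mem_maximalAtlas
        (h.domChart.map_source hx)
    exact c3.comp (ι x) c2
  have hc := mfderiv_comp x (hr.mdifferentiableAt (by simp)) hι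
  rw [hev.mfderiv_eq, mfderiv_id] at hc
  intro v w hvw
  have := congrArg (mfderiv I 𝓘(ℝ, V) r (ι x)) hvw
  have e : ∀ v, mfderiv I 𝓘(ℝ, V) r (ι x) (mfderiv 𝓘(ℝ, V) I ι x v) = v := fun v =>
    (DFunLike.congr_fun hc v).symm
  rwa [e, e] at this

end Submanifold

/-! ### The inverse function theorem on manifolds. -/

section InverseFunction

variable {E : Type*} [NormedAddCommGroup E] [NormedSpace ℝ E] {H : Type*} [TopologicalSpace H]
  {I : ModelWithCorners ℝ E H} {N : Type*} [TopologicalSpace N] [ChartedSpace H N]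

/-- Invertible operators form an open set and the derivative is continuous. This gives smoothness of
the local inverse on a whole open set rather than at one point. -/
theorem ContDiffOn.exists_isOpen_isInvertible {E F : Type*}
    [NormedAddCommGroup E] [NormedSpace ℝ E] [CompleteSpace E] [NormedAddCommGroup F] [NormedSpace ℝ F] {f : E → F} {O : Set E}
    (hO : IsOpen O) (hf : ContDiffOn ℝ ∞ f O) {x : E} (hx : x ∈ O) (L : E ≃L[ℝ] F) (hL : fderiv ℝ f x = L) :
    ∃ O' ⊆ O, IsOpen O' ∧ x ∈ O' ∧ ∀ y ∈ O', 
      ∃ L' : E ≃L[ℝ] F, HasFDerivAt f (L' : E →L[ℝ] F) y := by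
  refine ⟨O ∩ fderiv ℝ f ⁻¹' range ((↑) : (E ≃L[ℝ] F) → E →L[ℝ] F), inter_subset_left, ?_, ?_, ?_⟩
  · exact (hf.continuousOn_fderiv_of_isOpen hO (by simp)).isOpen_inter_preimage hO
      ContinuousLinearEquiv.isOpen
  · exact ⟨hx, L, hL.symm⟩
  · rintro y ⟨hy, L', hL'⟩
    refine ⟨L', ?_⟩
    rw [hL']
    exact ((hf.contDiffAt (hO.mem_nhds hy)).differentiableAt (by simp)).hasFDerivAt

variable [I.Boundaryless]

variable (I) in
/-- The preferred chart of a boundaryless manifold, with values in the model vector space. -/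
def vectorChartAt (x : N) : OpenPartialHomeomorph N E :=
  (chartAt H x).transHomeomorph I.toHomeomorph

theorem vectorChartAt_coe (x : N) : ⇑(vectorChartAt I x) = extChartAt I x := rfl

theorem vectorChartAt_source (x : N) : (vectorChartAt I x).source = (extChartAt I x).source := by
  rw [extChartAt_source]; rfl

theorem vectorChartAt_target (x : N) : (vectorChartAt I x).target = (extChartAt I x).target := by
  rw [← (vectorChartAt I x).image_source_eq_target, vectorChartAt_source, vectorChartAt_coe,
    (extChartAt I x).image_source_eq_target]

/-- The inverse function theorem for vector-valued maps on manifolds. -/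
theorem exists_openPartialHomeomorph_of_hasFDerivAt [CompleteSpace E]
    [IsManifold I ∞ N] {Ψ : N → E} {x : N} {W : Set N}
    (hW : IsOpen W) (hxW : x ∈ W) (hΨ : ContMDiffOn I 𝓘(ℝ, E) ∞ Ψ W) (L : E ≃L[ℝ] E)
    (hL : HasFDerivAt (Ψ ∘ (extChartAt I x).symm) (L : E →L[ℝ] E) (extChartAt I x x)) :
    ∃ Φ : OpenPartialHomeomorph N E, x ∈ Φ.source ∧ Φ.source ⊆ W ∧ EqOn Φ Ψ Φ.source ∧
      ContMDiffOn 𝓘(ℝ, E) I ∞ Φ.symm Φ.target := by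
  set e := vectorChartAt I x with he
  have hxe : x ∈ e.source := by rw [he, vectorChartAt_source]; exact mem_extChartAt_source x
  have hes : ContMDiffOn 𝓘(ℝ, E) I ∞ e.symm e.target := by
    rw [he, vectorChartAt_target]; exact contMDiffOn_extChartAt_symm x
  set O := e.target ∩ e.symm ⁻¹' W with hO
  have hOo : IsOpen O := e.continuousOn_symm.isOpen_inter_preimage e.open_target hW
  have hxO : e x ∈ O := ⟨e.map_source hxe, by rwa [mem_preimage, e.left_inv hxe]⟩
  have hψ : ContDiffOn ℝ ∞ (Ψ ∘ e.symm) O :=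
    (hΨ.comp (hes.mono inter_subset_left) fun z hz => hz.2).contDiffOn
  have hL1 : HasFDerivAt (Ψ ∘ e.symm) (L : E →L[ℝ] E) (e x) := hL
  obtain ⟨O', hO'O, hO'o, hxO', hinv⟩ := hψ.exists_isOpen_isInvertible hOo hxO L hL1.fderiv
  have hcd : ContDiffAt ℝ ∞ (Ψ ∘ e.symm) (e x) := hψ.contDiffAt (hOo.mem_nhds hxO)
  set G := hcd.toOpenPartialHomeomorph (Ψ ∘ e.symm) hL1 (by simp) with hG
  have hGc : ⇑G = Ψ ∘ e.symm := hcd.toOpenPartialHomeomorph_coe hL1 (by simp)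
  have hxG : e x ∈ G.source := hcd.mem_toOpenPartialHomeomorph_source hL1 (by simp)
  refine ⟨e.trans (G.restrOpen O' hO'o), ⟨hxe, hxG, hxO'⟩, ?_, ?_, ?_⟩
  · rintro y ⟨hy, -, hy'⟩
    have h1 : e.symm (e y) ∈ W := (hO'O hy').2
    rwa [e.left_inv hy] at h1
  · rintro y ⟨hy, -, -⟩
    change G (e y) = _
    rw [hGc, Function.comp_apply, e.left_inv hy]
  · intro w hw
    have hw1 : w ∈ G.target := hw.1.1
    have hw2 : G.symm w ∈ O' := hw.1.2
    have hw3 : G.symm w ∈ e.target := (hO'O hw2).1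
    obtain ⟨L', hL'⟩ := hinv _ hw2
    have h1 : ContDiffAt ℝ ∞ G.symm w := by
      refine G.contDiffAt_symm hw1 (f₀' := L') (by rw [hGc]; exact hL') ?_
      rw [hGc]
      exact hψ.contDiffAt (hOo.mem_nhds (hO'O hw2))
    exact ((hes.contMDiffAt (e.open_target.mem_nhds hw3)).comp w h1.contMDiffAt).contMDiffWithinAt

end InverseFunction


/-! ### Linearization of a map of finite order at a fixed point. -/

section FixedPoints

variable {E : Type*} [NormedAddCommGroup E] [NormedSpace ℝ E] {H : Type*} [TopologicalSpace H]
  (I : ModelWithCorners ℝ E H) {N : Type*} [TopologicalSpace N] [ChartedSpace H N]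

/-- The derivative of a self-map, as an endomorphism of the model vector space. -/
def modelDeriv (f : N → N) (x : N) : E →L[ℝ] E := mfderiv I I f x

variable {I}

theorem modelDeriv_comp {f g : N → N} {x : N} (hf : MDifferentiableAt I I f (g x))
    (hg : MDifferentiableAt I I g x) :
    modelDeriv I (f ∘ g) x = modelDeriv I f (g x) * modelDeriv I g x :=
  mfderiv_comp x hf hg

theorem modelDeriv_id (x : N) : modelDeriv I (id : N → N) x = 1 := mfderiv_id

theorem contMDiff_iterate {a : N → N} (ha : ContMDiff I I ∞ a) (k : ℕ) :
    ContMDiff I I ∞ a^[k] := by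
  induction k with
  | zero => exact contMDiff_id
  | succ k ih => exact ih.comp ha

theorem modelDeriv_iterate {a : N → N} (ha : ContMDiff I I ∞ a) {x : N} (hx : a x = x) (k : ℕ) :
    modelDeriv I a^[k] x = modelDeriv I a x ^ k := by
  induction k with
  | zero => exact modelDeriv_id x
  | succ k ih =>
    rw [Function.iterate_succ, modelDeriv_comp ((contMDiff_iterate ha k).mdifferentiableAt (by simp))
      (ha.mdifferentiableAt (by simp)), hx, ih, pow_succ]

/-- At a fixed point the preferred charts at source and target coincide, so the manifold derivative
is the derivative in a single chart. -/
theorem hasFDerivAt_modelDeriv [I.Boundaryless] {f : N → N} {x : N}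
    (hf : MDifferentiableAt I I f x) (hx : f x = x) :
    HasFDerivAt (fun z => extChartAt I x (f ((extChartAt I x).symm z))) (modelDeriv I f x)
      (extChartAt I x x) := by
  have h1 := hf.hasMFDerivAt.2
  have h2 : writtenInExtChartAt I I x f =
      fun z => extChartAt I x (f ((extChartAt I x).symm z)) := by
    unfold writtenInExtChartAt
    rw [hx]
    rfl
  have h3 : HasFDerivWithinAt (fun z => extChartAt I x (f ((extChartAt I x).symm z)))
      (modelDeriv I f x) (range I) (extChartAt I x x) := h2 ▸ h1
  rwa [I.range_eq_univ, hasFDerivWithinAt_univ] at h3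

/-- The subspace of vectors fixed by an endomorphism. -/
def fixedSubspace (A : E →L[ℝ] E) : Submodule ℝ E where
  carrier := {v | A v = v}
  zero_mem' := map_zero A
  add_mem' := by
    intro v w hv hw
    change A (v + w) = v + w
    rw [map_add, show A v = v from hv, show A w = w from hw]
  smul_mem' := by
    intro c v hv
    change A (c • v) = c • v
    rw [map_smul, show A v = v from hv]

theorem mem_fixedSubspace {A : E →L[ℝ] E} {v : E} : v ∈ fixedSubspace A ↔ A v = v := Iff.rfl

variable [I.Boundaryless] [IsManifold I ∞ N]

/-- A smooth map of finite order is linear in suitable charts around its fixed points; here `C` is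
the inverse of its linear part. -/
theorem exists_linearizing_chart [CompleteSpace E] {a : N → N} (ha : ContMDiff I I ∞ a) {r : ℕ}
    (hr : r ≠ 0) (har : a^[r] = id) {x : N} (hx : a x = x) :
    ∃ (Φ : OpenPartialHomeomorph N E) (C : E →L[ℝ] E), x ∈ Φ.source ∧
      ContMDiffOn I 𝓘(ℝ, E) ∞ Φ Φ.source ∧ ContMDiffOn 𝓘(ℝ, E) I ∞ Φ.symm Φ.target ∧
      (∀ y ∈ Φ.source, a y ∈ Φ.source → C (Φ (a y)) = Φ y) ∧ Function.Injective C := by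
  obtain ⟨n, rfl⟩ : ∃ n, r = n + 1 := ⟨r - 1, by omega⟩
  set A := modelDeriv I a x with hA
  have hAr : A ^ (n + 1) = 1 := by
    rw [hA, ← modelDeriv_iterate ha hx, har, modelDeriv_id]
  -- This is the inverse of `A`, because `A ^ (n + 1) = 1`.
  set C := A ^ n with hC
  have hCA : ∀ k, C ^ k * A ^ k = 1 := by
    intro k
    rw [hC, ← pow_mul, ← pow_add]
    rw [show n * k + k = (n + 1) * k by ring, pow_mul, hAr, one_pow]
  have hCr : C ^ (n + 1) = 1 := by rw [hC, ← pow_mul, mul_comm, pow_mul, hAr, one_pow]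
  set φ := extChartAt I x with hφ
  -- Averaging the chart over the cyclic group generated by `a` (Bochner's trick) makes it
  -- equivariant for the linear part.
  let Ψ : N → E := fun y => ((n + 1 : ℕ) : ℝ)⁻¹ •
    ∑ k ∈ Finset.range (n + 1), (C ^ k) (φ (a^[k] y))
  have hΨa : ∀ y, C (Ψ (a y)) = Ψ y := by
    intro y
    simp only [Ψ, map_smul, map_sum]
    congr 1
    have h1 : ∀ k, C ((C ^ k) (φ (a^[k] (a y)))) = (C ^ (k + 1)) (φ (a^[k + 1] y)) := by
      intro k
      rw [Function.iterate_succ_apply, pow_succ' C k]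
      rfl
    simp only [h1]
    -- The sum over `0, …, n + 1` is split at either end; the two extreme terms agree since `C` and
    -- `a` have order dividing `n + 1`.
    have h2 := Finset.sum_range_succ (fun k => (C ^ k) (φ (a^[k] y))) (n + 1)
    rw [Finset.sum_range_succ'] at h2
    simp only [hCr, har] at h2
    simpa using h2
  let W : Set N := ⋂ k ∈ Finset.range (n + 1), a^[k] ⁻¹' φ.source
  have hWo : IsOpen W := isOpen_biInter_finset fun k _ =>
    (isOpen_extChartAt_source x).preimage (contMDiff_iterate ha k).continuous
  have hak : ∀ k, a^[k] x = x := fun k => Function.iterate_fixed hx k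
  have hxW : x ∈ W := by
    simp only [W, mem_iInter, mem_preimage, hak]
    exact fun _ _ => mem_extChartAt_source x
  have hΨs : ContMDiffOn I 𝓘(ℝ, E) ∞ Ψ W := by
    have h1 : ∀ k ∈ Finset.range (n + 1),
        ContMDiffOn I 𝓘(ℝ, E) ∞ (fun y => (C ^ k) (φ (a^[k] y))) W := by
      intro k hk
      refine (C ^ k).contDiff.contMDiff.comp_contMDiffOn ?_
      refine (contMDiffOn_extChartAt (I := I) (x := x)).comp (contMDiff_iterate ha k).contMDiffOn ?_
      intro y hy
      rw [← extChartAt_source I]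
      exact mem_iInter₂.1 hy k hk
    have h2 := contMDiffOn_finsetSum h1
    exact (contDiff_const_smul _).contMDiff.comp_contMDiffOn h2
  -- Each summand has derivative `C ^ k * A ^ k = 1`, hence so has the average, and `Ψ` is a chart
  -- near `x`.
  have hder : HasFDerivAt (Ψ ∘ φ.symm) (ContinuousLinearEquiv.refl ℝ E : E →L[ℝ] E) (φ x) := by
    have h1 : ∀ k ∈ Finset.range (n + 1),
        HasFDerivAt (fun z => (C ^ k) (φ (a^[k] (φ.symm z)))) (1 : E →L[ℝ] E) (φ x) := by
      intro k _
      rw [← hCA k, hA, ← modelDeriv_iterate ha hx]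
      exact (C ^ k).hasFDerivAt.comp (φ x) (hasFDerivAt_modelDeriv
        ((contMDiff_iterate ha k).mdifferentiableAt (by simp)) (hak k))
    have h2 := (HasFDerivAt.fun_sum h1).const_smul (((n + 1 : ℕ) : ℝ)⁻¹)
    have h3 : ((n + 1 : ℕ) : ℝ)⁻¹ • ∑ _k ∈ Finset.range (n + 1), (1 : E →L[ℝ] E) =
        (ContinuousLinearEquiv.refl ℝ E : E →L[ℝ] E) := by
      rw [Finset.sum_const, Finset.card_range, ← Nat.cast_smul_eq_nsmul ℝ, smul_smul,
        inv_mul_cancel₀ (by positivity), one_smul]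
      rfl
    rw [h3] at h2
    exact h2
  obtain ⟨Φ, hxΦ, hΦW, hΦΨ, hΦs⟩ := exists_openPartialHomeomorph_of_hasFDerivAt hWo hxW hΨs _ hder
  refine ⟨Φ, C, hxΦ, (hΨs.mono hΦW).congr hΦΨ, hΦs, ?_, ?_⟩
  · intro y hy hay
    rw [hΦΨ hy, hΦΨ hay, hΨa]
  · intro v w hvw
    have h1 := congrArg (C ^ n) hvw
    have h2 : ∀ u, (C ^ n) (C u) = u := fun u => by
      have := DFunLike.congr_fun hCr u
      rwa [pow_succ] at this
    rwa [h2, h2] at h1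

end FixedPoints

/-! ### Local structure and components of the fixed point set. -/

section FixedPoints

variable {E : Type*} [NormedAddCommGroup E] [NormedSpace ℝ E] {H : Type*} [TopologicalSpace H]
  {I : ModelWithCorners ℝ E H} {N : Type*} [TopologicalSpace N] [ChartedSpace H N]

theorem OpenPartialHomeomorph.isLocalDiffeomorphAt {F : Type*} [NormedAddCommGroup F]
    [NormedSpace ℝ F] {H' : Type*} [TopologicalSpace H'] {J : ModelWithCorners ℝ F H'} {P : Type*}
    [TopologicalSpace P] [ChartedSpace H' P] (Φ : OpenPartialHomeomorph N P)
    (h : ContMDiffOn I J ∞ Φ Φ.source) (h' : ContMDiffOn J I ∞ Φ.symm Φ.target) {x : N}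
    (hx : x ∈ Φ.source) : IsLocalDiffeomorphAt I J ∞ Φ x :=
  ⟨⟨Φ.toPartialEquiv, Φ.open_source, Φ.open_target, h, h'⟩, hx, fun _ _ => rfl⟩

variable [I.Boundaryless] [IsManifold I ∞ N]

/-- Around a fixed point of a smooth map of finite order, the fixed point set is a linear subspace
in a suitable chart. -/
theorem exists_fixedPoints_chart [CompleteSpace E] {a : N → N} (ha : ContMDiff I I ∞ a) {r : ℕ}
    (hr : r ≠ 0) (har : a^[r] = id) {x : N} (hx : a x = x) :
    ∃ (Φ : OpenPartialHomeomorph N E) (K : Submodule ℝ E), x ∈ Φ.source ∧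
      ContMDiffOn I 𝓘(ℝ, E) ∞ Φ Φ.source ∧ ContMDiffOn 𝓘(ℝ, E) I ∞ Φ.symm Φ.target ∧
      (∀ y ∈ Φ.source, a y = y ↔ Φ y ∈ K) ∧
      (∀ y ∈ Φ.source, a y = y → Module.finrank ℝ (fixedSubspace (modelDeriv I a y)) =
        Module.finrank ℝ K) := by
  obtain ⟨Φ, C, hxΦ, hΦ, hΦs, hC, hCinj⟩ := exists_linearizing_chart ha hr har hx
  have hO : IsOpen (a ⁻¹' Φ.source) := Φ.open_source.preimage ha.continuous
  refine ⟨Φ.restrOpen _ hO, fixedSubspace C, ⟨hxΦ, by rwa [mem_preimage, hx]⟩,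
    hΦ.mono inter_subset_left, hΦs.mono fun _ h => h.1, ?_, ?_⟩
  · rintro y ⟨hy, hay⟩
    change a y = y ↔ C (Φ y) = Φ y
    have h1 := hC y hy hay
    constructor
    · intro h
      rwa [h] at h1
    · intro h
      rw [← h] at h1
      exact Φ.injOn hay hy (hCinj h1)
  · rintro y ⟨hy, -⟩ hay
    have hay' : a y ∈ Φ.source := by rwa [hay]
    have hld := Φ.isLocalDiffeomorphAt hΦ hΦs hy
    let T : E ≃L[ℝ] E := hld.mfderivToContinuousLinearEquiv (by simp)
    have hT : (T : E →L[ℝ] E) = mfderiv I 𝓘(ℝ, E) Φ y :=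
      hld.mfderivToContinuousLinearEquiv_coe (by simp)
    have hΦd : MDifferentiableAt I 𝓘(ℝ, E) Φ y := hld.contMDiffAt.mdifferentiableAt (by simp)
    have hΦd' : MDifferentiableAt I 𝓘(ℝ, E) Φ (a y) := by rwa [hay]
    have had : MDifferentiableAt I I a y := ha.mdifferentiableAt (by simp)
    have hev : (fun z => C (Φ (a z))) =ᶠ[𝓝 y] Φ := by
      filter_upwards [Φ.open_source.mem_nhds hy, hO.mem_nhds hay'] with z hz haz
        using hC z hz haz
    -- Differentiating `C ∘ Φ ∘ a = Φ` at `y`. Hence `T` carries the vectors fixed by the derivative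
    -- of `a` onto those fixed by `C`, whose dimension does not depend on `y`.
    have hcomp : ∀ v : E, C (T (modelDeriv I a y v)) = T v := by
      intro v
      have h1 : HasMFDerivAt I 𝓘(ℝ, E) (fun z => C (Φ (a z))) y _ :=
        C.hasMFDerivAt.comp y (hΦd'.hasMFDerivAt.comp y had.hasMFDerivAt)
      have h2 := (h1.congr_of_eventuallyEq hev.symm).mfderiv
      have h3 : mfderiv I 𝓘(ℝ, E) Φ (a y) = (T : E →L[ℝ] E) := by
        rw [hT]
        have : ∀ z, z = y → (mfderiv I 𝓘(ℝ, E) Φ z : E →L[ℝ] E) = mfderiv I 𝓘(ℝ, E) Φ y := by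
          rintro z rfl; rfl
        exact this _ hay
      rw [h3, ← hT] at h2
      exact (DFunLike.congr_fun h2 v).symm
    have hmap : (fixedSubspace (modelDeriv I a y)).map T.toLinearEquiv.toLinearMap =
        fixedSubspace C := by
      ext w
      rw [Submodule.mem_map]
      constructor
      · rintro ⟨v, hv, rfl⟩
        have := hcomp v
        rw [mem_fixedSubspace.1 hv] at this
        exact this
      · intro hw
        refine ⟨T.symm w, ?_, T.apply_symm_apply w⟩
        rw [mem_fixedSubspace]
        apply T.injective
        apply hCinj
        rw [hcomp, T.apply_symm_apply]
        exact (mem_fixedSubspace.1 hw).symm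
    rw [← hmap]
    exact (LinearEquiv.finrank_map_eq T.toLinearEquiv _).symm

/-- A linear splitting of a finite-dimensional space adapted to a subspace. -/
theorem exists_splitting {E : Type*} [NormedAddCommGroup E] [NormedSpace ℝ E]
    [FiniteDimensional ℝ E] (K : Submodule ℝ E) {d : ℕ}
    (hd : Module.finrank ℝ K = d) :
    ∃ θ : (EuclideanSpace ℝ (Fin d) × EuclideanSpace ℝ (Fin (Module.finrank ℝ E - d))) ≃L[ℝ] E,
      ∀ v, v ∈ K ↔ (θ.symm v).2 = 0 := by
  obtain ⟨K', hK'⟩ := K.exists_isCompl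
  have h1 := Submodule.finrank_add_eq_of_isCompl hK'
  let e1 : EuclideanSpace ℝ (Fin d) ≃ₗ[ℝ] K := LinearEquiv.ofFinrankEq _ _ (by simp [hd])
  let e2 : EuclideanSpace ℝ (Fin (Module.finrank ℝ E - d)) ≃ₗ[ℝ] K' :=
    LinearEquiv.ofFinrankEq _ _ (by simp; omega)
  let θ := ((e1.prodCongr e2).trans (Submodule.prodEquivOfIsCompl K K' hK')).toContinuousLinearEquiv
  refine ⟨θ, fun v => ?_⟩
  have h2 : θ.symm v = (e1.symm ((Submodule.prodEquivOfIsCompl K K' hK').symm v).1,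
    e2.symm ((Submodule.prodEquivOfIsCompl K K' hK').symm v).2) := rfl
  rw [h2]
  simp

/-- The linear chart is shrunk to `U`, where lying in `C` and being fixed are the same. The number
`d` is a parameter so that all points of a component get the same model spaces. -/
theorem exists_sliceChart [FiniteDimensional ℝ E] [CompleteSpace E] {a : N → N} (ha : ContMDiff I I ∞ a) {r : ℕ}
    (hr : r ≠ 0) (har : a^[r] = id) {x : N} (hx : a x = x) {C U : Set N} (hU : IsOpen U)
    (hxU : x ∈ U) (hCU : {y | a y = y} ∩ U = C) {d : ℕ}
    (hd : Module.finrank ℝ (fixedSubspace (modelDeriv I a x)) = d) :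
    Nonempty (SliceChart I (EuclideanSpace ℝ (Fin d))
      (EuclideanSpace ℝ (Fin (Module.finrank ℝ E - d))) C x) := by
  obtain ⟨Φ, K, hxΦ, hΦ, hΦs, hK, hdim⟩ := exists_fixedPoints_chart ha hr har hx
  obtain ⟨θ, hθ⟩ := exists_splitting K ((hdim x hxΦ hx).symm.trans hd)
  refine ⟨⟨(Φ.restrOpen U hU).transHomeomorph θ.symm.toHomeomorph, ⟨hxΦ, hxU⟩, ?_, ?_, ?_⟩⟩
  · exact θ.symm.contDiff.contMDiff.comp_contMDiffOn (hΦ.mono inter_subset_left)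
  · have h1 : ContMDiff 𝓘(ℝ, EuclideanSpace ℝ (Fin d) × EuclideanSpace ℝ
      (Fin (Module.finrank ℝ E - d))) 𝓘(ℝ, E) ∞ θ := θ.contDiff.contMDiff
    exact hΦs.comp h1.contMDiffOn fun y hy => hy.1
  · rintro p ⟨hp, hpU⟩
    rw [← hCU]
    change (a p = p ∧ p ∈ U) ↔ (θ.symm (Φ p)).2 = 0
    rw [← hθ, ← hK p hp]
    exact and_iff_left hpU

/-- In the linear chart the fixed points near `x` form a subspace intersected with a ball, which is
convex. -/
theorem exists_isPreconnected_fixedPoints [CompleteSpace E] {a : N → N} (ha : ContMDiff I I ∞ a)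
    {r : ℕ} (hr : r ≠ 0) (har : a^[r] = id) {x : N} (hx : a x = x) :
    ∃ W : Set N, IsOpen W ∧ x ∈ W ∧ IsPreconnected ({y | a y = y} ∩ W) ∧
      ∀ y ∈ W, a y = y → Module.finrank ℝ (fixedSubspace (modelDeriv I a y)) =
        Module.finrank ℝ (fixedSubspace (modelDeriv I a x)) := by
  obtain ⟨Φ, K, hxΦ, hΦ, hΦs, hK, hdim⟩ := exists_fixedPoints_chart ha hr har hx
  obtain ⟨ε, hε, hball⟩ := Metric.isOpen_iff.1 Φ.open_target (Φ x) (Φ.map_source hxΦ)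
  refine ⟨Φ.source ∩ Φ ⁻¹' Metric.ball (Φ x) ε,
    Φ.continuousOn.isOpen_inter_preimage Φ.open_source Metric.isOpen_ball,
    ⟨hxΦ, Metric.mem_ball_self hε⟩, ?_, fun y hy hay => by rw [hdim y hy.1 hay, hdim x hxΦ hx]⟩
  have himg : {y | a y = y} ∩ (Φ.source ∩ Φ ⁻¹' Metric.ball (Φ x) ε) =
      Φ.symm '' ((K : Set E) ∩ Metric.ball (Φ x) ε) := by
    ext y
    constructor
    · rintro ⟨hy, hys, hyb⟩
      exact ⟨Φ y, ⟨(hK y hys).1 hy, hyb⟩, Φ.left_inv hys⟩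
    · rintro ⟨v, ⟨hv, hvb⟩, rfl⟩
      have hvt := hball hvb
      refine ⟨?_, Φ.map_target hvt, ?_⟩
      · refine (hK _ (Φ.map_target hvt)).2 ?_
        rwa [Φ.right_inv hvt]
      · rwa [mem_preimage, Φ.right_inv hvt]
  rw [himg]
  exact (K.convex.inter (convex_ball _ _)).isPreconnected.image _
    (Φ.continuousOn_symm.mono fun v hv => hball hv.2)

/-- Components of the fixed point set are open in it, and the dimension is constant on them. -/
theorem connectedComponentIn_fixedPoints [CompleteSpace E] {a : N → N} (ha : ContMDiff I I ∞ a)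
    {r : ℕ} (hr : r ≠ 0) (har : a^[r] = id) (x : N) :
    (∃ U : Set N, IsOpen U ∧ {y | a y = y} ∩ U = connectedComponentIn {y | a y = y} x) ∧
    ∀ y ∈ connectedComponentIn {y | a y = y} x,
      Module.finrank ℝ (fixedSubspace (modelDeriv I a y)) =
        Module.finrank ℝ (fixedSubspace (modelDeriv I a x)) := by
  set S := {y | a y = y} with hS
  set C := connectedComponentIn S x with hC
  have hCS : C ⊆ S := connectedComponentIn_subset S x
  choose W hWo hyW hWc hWd using fun y : S => exists_isPreconnected_fixedPoints ha hr har y.2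
  have hWC : ∀ (y : N) (hy : y ∈ C), S ∩ W ⟨y, hCS hy⟩ ⊆ C := by
    intro y hy
    rw [hC, connectedComponentIn_eq hy]
    exact (hWc ⟨y, hCS hy⟩).subset_connectedComponentIn ⟨hCS hy, hyW ⟨y, hCS hy⟩⟩
      inter_subset_left
  refine ⟨⟨⋃ y : C, W ⟨y, hCS y.2⟩, isOpen_iUnion fun y => hWo _, ?_⟩, ?_⟩
  · ext z
    constructor
    · rintro ⟨hz, hzW⟩
      obtain ⟨y, hy⟩ := mem_iUnion.1 hzW
      exact hWC y y.2 ⟨hz, hy⟩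
    · intro hz
      exact ⟨hCS hz, mem_iUnion.2 ⟨⟨z, hz⟩, hyW ⟨z, hCS hz⟩⟩⟩
  · intro y hy
    have hx : x ∈ C := mem_connectedComponentIn (connectedComponentIn_nonempty_iff.1 ⟨y, hy⟩)
    -- The dimension is locally constant on `C`, hence continuous into the discrete space `ℕ`.
    refine isPreconnected_connectedComponentIn.constant (s := C)
      (f := fun y => Module.finrank ℝ (fixedSubspace (modelDeriv I a y))) ?_ hy hx
    intro z hz
    refine (continuousWithinAt_const (b := Module.finrank ℝ
      (fixedSubspace (modelDeriv I a z)))).congr_of_eventuallyEq ?_ rfl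
    filter_upwards [self_mem_nhdsWithin,
      mem_nhdsWithin_of_mem_nhds ((hWo ⟨z, hCS hz⟩).mem_nhds (hyW ⟨z, hCS hz⟩))] with y' hy' hyW'
    exact hWd ⟨z, hCS hz⟩ y' hyW' (hCS hy')

end FixedPoints

/-! ### The fixed point set of a symplectic map of finite order is symplectic. -/

section LinearAlgebra

/-- By invariance and `A u = u`, `s (u, w) = s (u, Aᵏ w)` for all `k`. Summing over `k < r` gives `r
· s (u, w) = s (u, ∑ Aᵏ w)`, which vanishes because the sum is fixed by `A`. -/
theorem eq_zero_of_twoForm_fixed {E : Type*} [NormedAddCommGroup E] [NormedSpace ℝ E]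
    (s : E [⋀^Fin 2]→L[ℝ] ℝ) (A : E →L[ℝ] E) (hs : ∀ v w, s ![A v, A w] = s ![v, w])
    (hnd : ∀ v, (∀ w, s ![v, w] = 0) → v = 0) {r : ℕ} (hr : r ≠ 0) (hA : A ^ r = 1) {u : E}
    (hu : A u = u) (h : ∀ w, A w = w → s ![u, w] = 0) : u = 0 := by
  refine hnd u fun w => ?_
  let ℓ : E →ₗ[ℝ] ℝ := s.toMultilinearMap.toLinearMap ![u, 0] 1
  have hℓ : ∀ w, ℓ w = s ![u, w] := by
    intro w
    change s (Function.update ![u, 0] 1 w) = _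
    congr 1
    ext i; fin_cases i <;> simp
  have hfix : A (∑ k ∈ Finset.range r, (A ^ k) w) = ∑ k ∈ Finset.range r, (A ^ k) w := by
    rw [map_sum]
    have h1 : ∀ k, A ((A ^ k) w) = (A ^ (k + 1)) w := fun k => by rw [pow_succ']; rfl
    simp only [h1]
    have h2 := Finset.sum_range_succ (fun k => (A ^ k) w) r
    rw [Finset.sum_range_succ', hA, pow_zero] at h2
    exact add_right_cancel h2
  have hpow : ∀ k, s ![u, (A ^ k) w] = s ![u, w] := by
    intro k
    induction k with
    | zero => simp
    | succ k ih =>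
      have h1 := hs u ((A ^ k) w)
      rw [hu] at h1
      rw [← ih, ← h1, pow_succ']
      rfl
  have h3 := h _ hfix
  rw [← hℓ, map_sum] at h3
  simp only [hℓ, hpow, Finset.sum_const, Finset.card_range, nsmul_eq_mul] at h3
  exact (mul_eq_zero.1 h3).resolve_left (by exact_mod_cast hr)

end LinearAlgebra

/-- The form on each component is the restriction of `σ`. Its tangent spaces are the fixed spaces of
the derivative of `a`, so nondegeneracy is the preceding linear statement. -/
theorem isSymplecticSubset_fixedPoints {E : Type*} [NormedAddCommGroup E] [NormedSpace ℝ E]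
    [FiniteDimensional ℝ E] {H : Type*} [TopologicalSpace H]
    {I : ModelWithCorners ℝ E H} [I.Boundaryless] {N : Type u} [TopologicalSpace N]
    [ChartedSpace H N] [IsManifold I ∞ N] {a : N → N} (ha : ContMDiff I I ∞ a) {r : ℕ}
    (hr : r ≠ 0) (har : a^[r] = id) {σ : TwoForm I N} (hσ : IsSymplecticForm I σ)
    (hσa : PreservesForm I σ a) : IsSymplecticSubset I {y | a y = y} := by
  have : CompleteSpace E := FiniteDimensional.complete ℝ E
  intro x hx
  obtain ⟨⟨U, hU, hSU⟩, hdim⟩ := connectedComponentIn_fixedPoints ha hr har x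
  refine ⟨⟨U, hU, hSU⟩, ?_⟩
  set d := Module.finrank ℝ (fixedSubspace (modelDeriv I a x)) with hd
  set C := connectedComponentIn {y | a y = y} x with hC
  have hCfix : ∀ y ∈ C, a y = y := fun y hy => connectedComponentIn_subset {y | a y = y} x hy
  let Φ : ∀ y : C, SliceChart I (EuclideanSpace ℝ (Fin d))
      (EuclideanSpace ℝ (Fin (Module.finrank ℝ E - d))) C (y : N) := fun y =>
    (exists_sliceChart ha hr har (hCfix y y.2) hU (hSU.symm.subset y.2).2 hSU
      (hdim y y.2)).some
  obtain ⟨θ, -⟩ := exists_splitting (fixedSubspace (modelDeriv I a x)) hd.symm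
  let cs := sliceChartedSpace I Φ
  have hman := isManifold_slice I Φ
  have hemb := isSmoothEmbedding_slice I θ Φ
  refine ⟨d, C, inferInstance, cs, hman, Subtype.val, TwoForm.pullback (𝓡 d) I Subtype.val σ,
    hemb, Subtype.range_coe, ?_⟩
  rw [isSymplecticForm_iff] at hσ ⊢
  refine ⟨hσ.1.pullback hemb.contMDiff, fun p v hv => ?_⟩
  have hinj := (hemb.isImmersion.isImmersionAt p).injective_mfderiv
  let D : EuclideanSpace ℝ (Fin d) →L[ℝ] E := mfderiv (𝓡 d) I (Subtype.val : C → N) p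
  have hap := hCfix p p.2
  have hDfix : ∀ v, modelDeriv I a p (D v) = D v := by
    intro v
    have h1 : a ∘ (Subtype.val : C → N) = Subtype.val := funext fun y => hCfix y y.2
    have h2 := mfderiv_comp_apply p (ha.mdifferentiableAt (by simp))
      (hemb.contMDiff.mdifferentiableAt (by simp)) v
    rw [h1] at h2
    exact h2.symm
  -- The image of `D` lies in the fixed subspace, and both have dimension `d`.
  have hrange : ∀ w, modelDeriv I a p w = w → ∃ v, D v = w := by
    have hle : LinearMap.range D.toLinearMap ≤ fixedSubspace (modelDeriv I a p) := by
      rintro _ ⟨v, rfl⟩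
      exact hDfix v
    have hfr : Module.finrank ℝ (LinearMap.range D.toLinearMap) = d := by
      rw [LinearMap.finrank_range_of_inj (f := D.toLinearMap) hinj, finrank_euclideanSpace_fin]
    have heq := Submodule.eq_of_le_of_finrank_eq hle (hfr.trans (hdim p p.2).symm)
    intro w hw
    have : w ∈ LinearMap.range D.toLinearMap := by
      rw [heq]; exact hw
    exact this
  have key : D v = 0 := by
    refine eq_zero_of_twoForm_fixed (E := E) (σ p) (modelDeriv I a p) ?_ (hσ.2 p) hr ?_ (hDfix v) ?_
    · intro v w
      have h1 : ∀ q, q = (p : N) → (σ q : E [⋀^Fin 2]→L[ℝ] ℝ) = σ p := by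
        rintro _ rfl; rfl
      have h2 := congrArg (fun s : E [⋀^Fin 2]→L[ℝ] ℝ => s ![v, w]) (hσa p)
      rw [← h2, ← h1 _ hap]
      exact (TwoForm.pullback_apply a σ (p : N) v w).symm
    · rw [← modelDeriv_iterate ha hap, har, modelDeriv_id]
    · intro w hw
      obtain ⟨w, rfl⟩ := hrange w hw
      exact (TwoForm.pullback_apply _ _ _ _ _).symm.trans (hv w)
  exact hinj (key.trans (map_zero D).symm)

/-! ### Smooth maps and diffeomorphic subsets via covers. -/

section Covers

variable {E : Type*} [NormedAddCommGroup E] [NormedSpace ℝ E] {H : Type*} [TopologicalSpace H]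
  {I : ModelWithCorners ℝ E H} {X : Type*} [TopologicalSpace X] [ChartedSpace H X]
  {E' : Type*} [NormedAddCommGroup E'] [NormedSpace ℝ E'] {H' : Type*} [TopologicalSpace H']
  {J : ModelWithCorners ℝ E' H'} {N : Type*} [TopologicalSpace N] [ChartedSpace H' N]
  {E₁ : Type*} [NormedAddCommGroup E₁] [NormedSpace ℝ E₁] {H₁ : Type*} [TopologicalSpace H₁]
  {I₁ : ModelWithCorners ℝ E₁ H₁} {X₁ : Type*} [TopologicalSpace X₁] [ChartedSpace H₁ X₁]
  {E₂ : Type*} [NormedAddCommGroup E₂] [NormedSpace ℝ E₂] {H₂ : Type*} [TopologicalSpace H₂]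
  {I₂ : ModelWithCorners ℝ E₂ H₂} {N₁ : Type*} [TopologicalSpace N₁] [ChartedSpace H₂ N₁]

theorem IsLocalDiffeomorph.prodMap {f : X → N} {f₁ : X₁ → N₁} (h : IsLocalDiffeomorph I J ∞ f)
    (h₁ : IsLocalDiffeomorph I₁ I₂ ∞ f₁) :
    IsLocalDiffeomorph (I.prod I₁) (J.prod I₂) ∞ (Prod.map f f₁) := by
  rintro ⟨x, x₁⟩
  obtain ⟨Φ, hx, hΦ⟩ := h x
  obtain ⟨Φ₁, hx₁, hΦ₁⟩ := h₁ x₁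
  refine ⟨⟨Φ.toPartialEquiv.prod Φ₁.toPartialEquiv, Φ.open_source.prod Φ₁.open_source,
    Φ.open_target.prod Φ₁.open_target, Φ.contMDiffOn_toFun.prodMap Φ₁.contMDiffOn_toFun,
    Φ.contMDiffOn_invFun.prodMap Φ₁.contMDiffOn_invFun⟩, ⟨hx, hx₁⟩, ?_⟩
  rintro ⟨y, y₁⟩ ⟨hy, hy₁⟩
  exact Prod.ext (hΦ hy) (hΦ₁ hy₁)

theorem IsLocalDiffeomorph.id : IsLocalDiffeomorph I I ∞ (id : X → X) :=
  (Diffeomorph.refl I X ∞).isLocalDiffeomorph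

/-- Smoothness of a map can be checked on a cover of its source. -/
theorem ContMDiff.of_comp_isLocalDiffeomorph {f : X → N} (hf : IsLocalDiffeomorph I J ∞ f)
    (hsurj : Function.Surjective f) {h : N → N₁} (hh : ContMDiff I I₂ ∞ (h ∘ f)) :
    ContMDiff J I₂ ∞ h := by
  intro y
  obtain ⟨x, rfl⟩ := hsurj y
  obtain ⟨s, U, hU, hxU, hs, -, hfs⟩ := (hf x).exists_section
  refine ((hh.contMDiffAt (x := s (f x))).comp (f x)
    (hs.contMDiffAt (hU.mem_nhds hxU))).congr_of_eventuallyEq ?_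
  filter_upwards [hU.mem_nhds hxU] with z hz
  simp only [Function.comp_apply, hfs z hz]

/-- Subsets of two manifolds with a common cover are diffeomorphic if they have the same preimage
and if the two covering maps identify the same points of this preimage. -/
theorem areDiffeomorphicSubsets_of_cover {f : X → N} {f₁ : X → N₁}
    (hf : IsLocalDiffeomorph I J ∞ f) (hsurj : Function.Surjective f)
    (hf₁ : IsLocalDiffeomorph I I₂ ∞ f₁) (hsurj₁ : Function.Surjective f₁) {A : Set N} {B : Set N₁}
    (hAB : ∀ x, f x ∈ A ↔ f₁ x ∈ B)
    (hfib : ∀ x x', f x ∈ A → f x' ∈ A → (f x = f x' ↔ f₁ x = f₁ x')) :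
    AreDiffeomorphicSubsets J I₂ A B := by
  choose q hq using hsurj
  choose q₁ hq₁ using hsurj₁
  have hqA : ∀ a : A, f (q a) ∈ A := fun a => by rw [hq]; exact a.2
  have hqB : ∀ b : B, f (q₁ b) ∈ A := fun b => by rw [hAB, hq₁]; exact b.2
  let e : A ≃ B :=
    { toFun := fun a => ⟨f₁ (q a), (hAB _).1 (hqA a)⟩
      invFun := fun b => ⟨f (q₁ b), hqB b⟩
      left_inv := fun a => Subtype.ext <| by
        change f (q₁ (f₁ (q a))) = a
        rw [← hq a, hfib _ _ (by rw [hAB, hq₁, ← hAB]; simp [hq]) (hqA a), hq₁, hq]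
      right_inv := fun b => Subtype.ext <| by
        change f₁ (q (f (q₁ b))) = b
        have h1 : f (q (f (q₁ b))) = f (q₁ b) := hq _
        rw [hfib _ _ (by rw [h1]; exact hqB b) (hqB b)] at h1
        rw [h1, hq₁] }
  have he : ∀ x (hx : f x ∈ A), (e ⟨f x, hx⟩ : N₁) = f₁ x := by
    intro x hx
    change f₁ (q (f x)) = f₁ x
    rw [← hfib _ _ (by rwa [hq]) hx, hq]
  refine ⟨e, fun a => ?_, fun b => ?_⟩
  · obtain ⟨s, U, hU, hxU, hs, -, hfs⟩ := (hf (q a)).exists_section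
    rw [hq] at hxU
    -- The bijection extends smoothly to the ambient open set `U`: lift by a local section of `f`,
    -- then project by `f₁`.
    refine ⟨U, hU, hxU, f₁ ∘ s, hf₁.contMDiff.comp_contMDiffOn hs, fun c hc => ?_⟩
    have h1 : f (s c) ∈ A := by rw [hfs c hc]; exact c.2
    rw [Function.comp_apply, ← he _ h1]
    congr 2
    exact Subtype.ext (hfs c hc)
  · obtain ⟨s, U, hU, hxU, hs, -, hfs⟩ := (hf₁ (q₁ b)).exists_section
    rw [hq₁] at hxU
    refine ⟨U, hU, hxU, f ∘ s, hf.contMDiff.comp_contMDiffOn hs, fun c hc => ?_⟩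
    have h1 : f (s c) ∈ A := by rw [hAB, hfs c hc]; exact c.2
    have h2 : c = e ⟨f (s c), h1⟩ := Subtype.ext (by rw [he, hfs c hc])
    have h3 : e.symm c = ⟨f (s c), h1⟩ := e.injective (by rw [Equiv.apply_symm_apply, ← h2])
    exact (congrArg Subtype.val h3).symm

end Covers

/-! ### The universal cover of the circle. -/

section Circle

/-- The universal cover `t ↦ exp (2πit)` of the circle. -/
def circleCover (t : ℝ) : Circle := Circle.exp (2 * Real.pi * t)

theorem circleCover_add (s t : ℝ) : circleCover (s + t) = circleCover s * circleCover t := by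
  rw [circleCover, mul_add, Circle.exp_add]; rfl

theorem circleCover_eq_iff {s t : ℝ} : circleCover s = circleCover t ↔ ∃ n : ℤ, s = t + n := by
  rw [circleCover, circleCover, Circle.exp_eq_exp]
  refine exists_congr fun n => ?_
  have := Real.pi_pos
  constructor
  · intro h
    have h1 : (2 * Real.pi) * (s - (t + n)) = 0 := by linarith
    rcases mul_eq_zero.1 h1 with h2 | h2
    · linarith
    · linarith
  · rintro rfl
    ring

theorem circleCover_surjective : Function.Surjective circleCover := by
  intro z
  refine ⟨Complex.arg z / (2 * Real.pi), ?_⟩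
  rw [circleCover, mul_div_cancel₀ _ (by positivity), Circle.exp_arg]

theorem contMDiff_circleCover : ContMDiff 𝓘(ℝ, ℝ) (𝓡 1) ∞ circleCover :=
  contMDiff_circleExp.comp (contDiff_const.mul contDiff_id).contMDiff

/-- After rotating `t₀` to the point `1`, the inverse is the principal argument, which is smooth on
the slit plane as the imaginary part of the logarithm. -/
theorem isLocalDiffeomorph_circleCover : IsLocalDiffeomorph 𝓘(ℝ, ℝ) (𝓡 1) ∞ circleCover := by
  intro t₀
  have hp := Real.pi_pos
  have := finrank_real_complex_fact'
  let m : Circle → Circle := fun w => circleCover (-t₀) * w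
  have hm : ContMDiff (𝓡 1) (𝓡 1) ∞ m := contMDiff_mul_left
  have hmc : ContMDiff (𝓡 1) 𝓘(ℝ, ℂ) ∞ (fun w => ((m w : Circle) : ℂ)) :=
    (contMDiff_coe_sphere (n := 1) (E := ℂ)).comp hm
  have hmt : ∀ t, m (circleCover t) = Circle.exp (2 * Real.pi * (t - t₀)) := by
    intro t
    simp only [m]
    rw [← circleCover_add, circleCover]
    congr 1; ring
  have harg : ∀ t ∈ Ioo (t₀ - 1 / 2) (t₀ + 1 / 2),
      Complex.arg (Circle.exp (2 * Real.pi * (t - t₀))) = 2 * Real.pi * (t - t₀) := fun t ht =>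
    Circle.arg_exp (by nlinarith [ht.1]) (by nlinarith [ht.2])
  refine ⟨⟨⟨circleCover, fun w => t₀ + Complex.arg (m w) / (2 * Real.pi), Ioo (t₀ - 1 / 2) (t₀ + 1 / 2),
    {w | (m w : ℂ) ∈ Complex.slitPlane}, ?_, ?_, ?_, ?_⟩, isOpen_Ioo, ?_, ?_, ?_⟩, ?_, fun _ _ => rfl⟩
  · intro t ht
    have h1 : (m (circleCover t) : ℂ) ∈ Complex.slitPlane := by
      rw [hmt, Complex.mem_slitPlane_iff_arg, harg t ht]
      exact ⟨by nlinarith [ht.2], Circle.coe_ne_zero _⟩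
    exact h1
  · intro w hw
    have h1 := Complex.mem_slitPlane_iff_arg.1 (show (m w : ℂ) ∈ Complex.slitPlane from hw)
    have h2 := Complex.neg_pi_lt_arg (m w : ℂ)
    have h3 := lt_of_le_of_ne (Complex.arg_le_pi (m w : ℂ)) h1.1
    constructor
    · have : -(1 / 2) < Complex.arg (m w) / (2 * Real.pi) := by
        rw [lt_div_iff₀ (by positivity)]; linarith
      linarith
    · have : Complex.arg (m w) / (2 * Real.pi) < 1 / 2 := by
        rw [div_lt_iff₀ (by positivity)]; linarith
      linarith
  · intro t ht
    rw [hmt, harg t ht]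
    field_simp
    ring
  · intro w hw
    rw [circleCover_add]
    have h1 : circleCover (Complex.arg (m w) / (2 * Real.pi)) = m w := by
      rw [circleCover, mul_div_cancel₀ _ (by positivity), Circle.exp_arg]
    rw [h1]
    simp only [m]
    rw [← mul_assoc, ← circleCover_add, add_neg_cancel]
    simp [circleCover]
  · exact Complex.isOpen_slitPlane.preimage hmc.continuous
  · exact contMDiff_circleCover.contMDiffOn
  · intro w hw
    have h1 : ContDiffAt ℝ ∞ Complex.log (m w : ℂ) :=
      (Complex.contDiffAt_log hw).restrict_scalars ℝ
    have h2 : ContDiffAt ℝ ∞ (fun z : ℂ => (Complex.log z).im) (m w : ℂ) :=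
      Complex.imCLM.contDiff.contDiffAt.comp _ h1
    simp only [Complex.log_im] at h2
    have h3 : ContDiffAt ℝ ∞ (fun z : ℂ => t₀ + Complex.arg z / (2 * Real.pi)) (m w : ℂ) :=
      contDiffAt_const.add (h2.div_const _)
    exact (h3.contMDiffAt.comp w hmc.contMDiffAt).contMDiffWithinAt
  · constructor <;> linarith

end Circle

/-- The quotient atlas uses a single chosen preimage of each point; this exposes the choice. -/
theorem IsLocalHomeomorph.exists_trans_chartAt_mem_atlas {H X Y : Type*} [TopologicalSpace H]
    [TopologicalSpace X] [TopologicalSpace Y] [ChartedSpace H X] {f : X → Y}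
    (hf : IsLocalHomeomorph f) (hf' : Function.Surjective f) (y : Y) :
    ∃ x : X, f x = y ∧ (hf.localInverseAt x).trans (chartAt H x) ∈
      (hf.chartedSpace (H := H) hf').atlas :=
  ⟨hf'.hasRightInverse.choose y, hf'.hasRightInverse.choose_spec y, y, rfl⟩

/-! ### The projection from the infinite cyclic cover to the mapping torus. -/

section MappingTorusCover

variable {E : Type*} [NormedAddCommGroup E] [NormedSpace ℝ E] {H : Type*} [TopologicalSpace H]
  {I : ModelWithCorners ℝ E H} {M : Type*} [TopologicalSpace M] [ChartedSpace H M]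
  (g : M ≃ₘ⟮I, I⟯ M)

/-- The projection from `ℝ × M` to the mapping torus. -/
def mappingTorusProj (p : ℝ × M) : MappingTorus g :=
  Quotient.mk (MulAction.orbitRel (Multiplicative ℤ) (MappingTorusCover g)) p

theorem mappingTorusProj_surjective : Function.Surjective (mappingTorusProj g) :=
  Quotient.mk_surjective

theorem mappingTorusProj_eq_iff {t t' : ℝ} {x x' : M} :
    mappingTorusProj g (t, x) = mappingTorusProj g (t', x') ↔
      ∃ n : ℤ, t' = t - n ∧ x' = ((g.toEquiv : Equiv.Perm M) ^ n) x := by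
  rw [eq_comm]
  constructor
  · intro h
    obtain ⟨n, hn⟩ := MulAction.orbitRel_apply.1 (Quotient.exact h)
    exact ⟨n.toAdd, (congrArg Prod.fst hn).symm, (congrArg Prod.snd hn).symm⟩
  · rintro ⟨n, rfl, rfl⟩
    exact Quotient.sound (MulAction.orbitRel_apply.2 ⟨Multiplicative.ofAdd n, rfl⟩)

/-- The projection from the infinite cyclic cover to the mapping torus. -/
def MappingTorusCover.proj (p : MappingTorusCover g) : MappingTorus g :=
  Quotient.mk (MulAction.orbitRel (Multiplicative ℤ) (MappingTorusCover g)) p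

variable [T2Space M] [LocallyCompactSpace M]

theorem MappingTorusCover.isLocalHomeomorph_proj : IsLocalHomeomorph (MappingTorusCover.proj g) :=
  (isQuotientCoveringMap_quotientMk_of_properlyDiscontinuousSMul
    (G := Multiplicative ℤ) (E := MappingTorusCover g)).isCoveringMap.isLocalHomeomorph

/-- In the charts `c` upstairs and `e` downstairs the projection is the identity, that is, it equals
`e.symm ∘ c` near `q`. -/
theorem MappingTorusCover.isLocalDiffeomorphAt_proj_of_mem_atlas [IsManifold I ∞ M]
    (q : MappingTorusCover g)
    (hmem : ((isLocalHomeomorph_proj g).localInverseAt q).trans (chartAt (ModelProd ℝ H) q) ∈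
      atlas (ModelProd ℝ H) (MappingTorus g)) :
    IsLocalDiffeomorphAt (𝓘(ℝ, ℝ).prod I) (𝓘(ℝ, ℝ).prod I) ∞ (MappingTorusCover.proj g) q := by
  have hcm := IsManifold.chart_mem_maximalAtlas (I := 𝓘(ℝ, ℝ).prod I) (n := ∞) q
  set c := chartAt (ModelProd ℝ H) q
  set ℓ := (isLocalHomeomorph_proj g).localInverseAt q with hℓ
  have hqℓ : q ∈ ℓ.target := (isLocalHomeomorph_proj g).self_mem_localInverseAt_target
  have hqc : q ∈ c.source := mem_chart_source _ q
  have hℓs : ⇑ℓ.symm = proj g := (isLocalHomeomorph_proj g).localInverseAt_symm q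
  have hem := IsManifold.subset_maximalAtlas (I := 𝓘(ℝ, ℝ).prod I) (n := ∞) hmem
  set e := ℓ.trans c with he
  have hc1 := contMDiffOn_of_mem_maximalAtlas hcm
  have hc2 := contMDiffOn_symm_of_mem_maximalAtlas hcm
  have he1 := contMDiffOn_of_mem_maximalAtlas hem
  have he2 := contMDiffOn_symm_of_mem_maximalAtlas hem
  have hqe : q ∈ (c.trans e.symm).source := by
    refine ⟨hqc, ?_⟩
    change c q ∈ e.target
    rw [he, OpenPartialHomeomorph.trans_target]
    exact ⟨c.map_source hqc, by rwa [mem_preimage, c.left_inv hqc]⟩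
  refine ⟨⟨(c.trans e.symm).toPartialEquiv, (c.trans e.symm).open_source,
    (c.trans e.symm).open_target, he2.comp (hc1.mono inter_subset_left) inter_subset_right,
    hc2.comp (he1.mono inter_subset_left) inter_subset_right⟩, hqe, fun y hy => ?_⟩
  change proj g y = ℓ.symm (c.symm (c y))
  rw [c.left_inv hy.1, hℓs]

theorem MappingTorusCover.exists_trans_chartAt_mem_atlas (x : MappingTorus g) :
    ∃ q : MappingTorusCover g, proj g q = x ∧
      ((isLocalHomeomorph_proj g).localInverseAt q).trans (chartAt (ModelProd ℝ H) q) ∈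
        atlas (ModelProd ℝ H) (MappingTorus g) :=
  (isLocalHomeomorph_proj g).exists_trans_chartAt_mem_atlas Quotient.mk_surjective x

/-- The atlas handles only the chosen preimage `q` of each point; any other point `p` of the fibre
is moved to `q` by a deck transformation. -/
theorem MappingTorusCover.isLocalDiffeomorph_proj [IsManifold I ∞ M] :
    IsLocalDiffeomorph (𝓘(ℝ, ℝ).prod I) (𝓘(ℝ, ℝ).prod I) ∞ (MappingTorusCover.proj g) := by
  intro p
  obtain ⟨q, hq, hmem⟩ := exists_trans_chartAt_mem_atlas g (proj g p)
  obtain ⟨n, hn⟩ := MulAction.orbitRel_apply.1 (Quotient.exact hq)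
  let D := smulDiffeomorph (MappingTorusCover.contMDiff_smul_cover g) n
  have hpq : proj g ∘ D = proj g := funext fun y =>
    Quotient.sound (MulAction.orbitRel_apply.2 ⟨n, rfl⟩)
  have hDp : D p = q := hn
  have h : IsLocalDiffeomorphAt (𝓘(ℝ, ℝ).prod I) (𝓘(ℝ, ℝ).prod I) ∞ (proj g) q :=
    isLocalDiffeomorphAt_proj_of_mem_atlas g q hmem
  rw [← hDp] at h
  have h1 := (D.isLocalDiffeomorph p).comp (𝓘(ℝ, ℝ).prod I) (MappingTorus g) h
  rwa [hpq] at h1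

theorem isLocalDiffeomorph_mappingTorusProj [IsManifold I ∞ M] :
    IsLocalDiffeomorph (𝓘(ℝ, ℝ).prod I) (𝓘(ℝ, ℝ).prod I) ∞ (mappingTorusProj g) :=
  MappingTorusCover.isLocalDiffeomorph_proj g

end MappingTorusCover

/-! ### The area form of the plane. -/

section AreaForm

/-- The standard area form on the plane. -/
def planeAreaForm : (ℝ × ℝ) [⋀^Fin 2]→L[ℝ] ℝ :=
  { (Module.Basis.finTwoProd ℝ).det with
    cont := by
      change Continuous fun v : Fin 2 → ℝ × ℝ => (Module.Basis.finTwoProd ℝ).det v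
      have h : (fun v : Fin 2 → ℝ × ℝ => (Module.Basis.finTwoProd ℝ).det v) =
          fun v => (v 0).1 * (v 1).2 - (v 1).1 * (v 0).2 := by
        funext v
        simp [Module.Basis.det_apply, Matrix.det_fin_two, Module.Basis.toMatrix_apply]
      rw [h]
      fun_prop }

theorem planeAreaForm_apply (v w : ℝ × ℝ) :
    planeAreaForm ![v, w] = v.1 * w.2 - w.1 * v.2 := by
  change (Module.Basis.finTwoProd ℝ).det ![v, w] = _
  simp [Module.Basis.det_apply, Matrix.det_fin_two, Module.Basis.toMatrix_apply]

/-- The standard area form on the plane, as a differential form. -/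
def planeForm : TwoForm 𝓘(ℝ, ℝ × ℝ) (ℝ × ℝ) := fun _ => planeAreaForm

end AreaForm

/-! ### Integer powers of a diffeomorphism. -/

section Powers

variable {E : Type*} [NormedAddCommGroup E] [NormedSpace ℝ E] {H : Type*} [TopologicalSpace H]
  {I : ModelWithCorners ℝ E H} {M : Type*} [TopologicalSpace M] [ChartedSpace H M]

/-- The integer powers of a diffeomorphism. -/
def Diffeomorph.zpow (g : M ≃ₘ⟮I, I⟯ M) (n : ℤ) : M ≃ₘ⟮I, I⟯ M where
  toEquiv := (g.toEquiv : Equiv.Perm M) ^ n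
  contMDiff_toFun := contMDiff_diffeomorph_zpow g n
  contMDiff_invFun := by
    have h := contMDiff_diffeomorph_zpow g (-n)
    rw [zpow_neg] at h
    exact h

theorem Diffeomorph.zpow_add_apply (g : M ≃ₘ⟮I, I⟯ M) (m n : ℤ) (x : M) :
    g.zpow (m + n) x = g.zpow m (g.zpow n x) := by
  change ((g.toEquiv : Equiv.Perm M) ^ (m + n)) x = _
  rw [_root_.zpow_add, Equiv.Perm.mul_apply]
  rfl

theorem Diffeomorph.zpow_one_apply (g : M ≃ₘ⟮I, I⟯ M) (x : M) : g.zpow 1 x = g x := by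
  change ((g.toEquiv : Equiv.Perm M) ^ (1 : ℤ)) x = _
  rw [_root_.zpow_one]
  rfl

theorem Diffeomorph.zpow_zero_apply (g : M ≃ₘ⟮I, I⟯ M) (x : M) : g.zpow 0 x = x := rfl

theorem PreservesForm.comp {η : TwoForm I M} {f g : M → M} (hf : PreservesForm I η f)
    (hg : PreservesForm I η g) (hfs : ContMDiff I I ∞ f) (hgs : ContMDiff I I ∞ g) :
    PreservesForm I η (f ∘ g) := by
  rw [preservesForm_iff] at *
  funext x
  rw [TwoForm.pullback_comp η (hfs.mdifferentiable (by simp) _) (hgs.mdifferentiable (by simp) _),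
    hf, hg]

theorem PreservesForm.symm {η : TwoForm I M} {f : M ≃ₘ⟮I, I⟯ M} (hf : PreservesForm I η f) :
    PreservesForm I η f.symm := by
  rw [preservesForm_iff] at *
  refine TwoForm.pullback_injective f.isLocalDiffeomorph f.surjective ?_
  funext x
  rw [← TwoForm.pullback_comp η (f.symm.mdifferentiable (by simp) _)
    (f.mdifferentiable (by simp) _), hf]
  refine TwoForm.ext_apply fun v w => ?_
  have h : f.symm ∘ f = id := funext f.symm_apply_apply
  rw [h, TwoForm.pullback_apply, mfderiv_id]
  rfl

theorem PreservesForm.zpow {η : TwoForm I M} {f : M ≃ₘ⟮I, I⟯ M} (hf : PreservesForm I η f) (n : ℤ) :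
    PreservesForm I η (f.zpow n) := by
  have key : ∀ n : ℤ, PreservesForm I η (f.zpow n) → PreservesForm I η (f.zpow (n + 1)) := by
    intro n hn
    have h : ⇑(f.zpow (n + 1)) = f.zpow n ∘ f :=
      funext fun x => by rw [Diffeomorph.zpow_add_apply, Diffeomorph.zpow_one_apply]; rfl
    rw [h]
    exact hn.comp hf (f.zpow n).contMDiff f.contMDiff
  induction n with
  | zero =>
    rw [preservesForm_iff]
    funext x
    refine TwoForm.ext_apply fun v w => ?_
    have h : ⇑(f.zpow 0) = id := rfl
    rw [h, TwoForm.pullback_apply, mfderiv_id]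
    rfl
  | succ n ih => exact key _ ih
  | pred n ih =>
    have h : ⇑(f.zpow (-(n : ℤ) - 1)) = f.zpow (-(n : ℤ)) ∘ f.symm := funext fun x => by
      obtain ⟨y, rfl⟩ := f.surjective x
      change f.zpow _ (f y) = f.zpow _ (f.symm (f y))
      rw [f.symm_apply_apply, ← Diffeomorph.zpow_one_apply f y,
        ← Diffeomorph.zpow_add_apply, sub_add_cancel]
    rw [h]
    exact ih.comp hf.symm (f.zpow _).contMDiff f.symm.contMDiff

end Powers

/-! ### From an isotopy to an equivariant family. -/

section Interpolation

variable {E : Type*} [NormedAddCommGroup E] [NormedSpace ℝ E] {H : Type*} [TopologicalSpace H]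
  {I : ModelWithCorners ℝ E H} {M : Type*} [TopologicalSpace M] [ChartedSpace H M]
  {f g : M ≃ₘ⟮I, I⟯ M}

/-- An isotopy can be reparametrized to be constant near both ends. -/
theorem AreIsotopic.exists_flat (h : AreIsotopic g f) :
    ∃ Φ : ℝ → (M ≃ₘ⟮I, I⟯ M), (∀ t ≤ 1 / 4, Φ t = f) ∧ (∀ t ≥ 3 / 4, Φ t = g) ∧
      ContMDiff (𝓘(ℝ, ℝ).prod I) I ∞ (fun p : ℝ × M => Φ p.1 p.2) := by
  obtain ⟨Φ, h0, h1, hΦ⟩ := h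
  -- Time is reversed, to run from `f` to `g`. The argument `2 t - 1 / 2` is at most `0` for `t ≤ 1
  -- / 4` and at least `1` for `t ≥ 3 / 4`.
  refine ⟨fun t => Φ (1 - Real.smoothTransition (2 * t - 1 / 2)), fun t ht => ?_, fun t ht => ?_, ?_⟩
  · simp only
    rw [Real.smoothTransition.zero_of_nonpos (by linarith), sub_zero, h1]
  · simp only
    rw [Real.smoothTransition.one_of_one_le (by linarith), sub_self, h0]
  · have h2 : ContDiff ℝ ∞ fun t : ℝ => 1 - Real.smoothTransition (2 * t - 1 / 2) :=
      contDiff_const.sub (Real.smoothTransition.contDiff.comp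
        ((contDiff_const.mul contDiff_id).sub contDiff_const))
    refine hΦ.comp_contMDiff (f := fun p : ℝ × M =>
      ((1 - Real.smoothTransition (2 * p.1 - 1 / 2), p.2) : ℝ × M))
      ((h2.contMDiff.comp contMDiff_fst).prodMk contMDiff_snd) fun p => ⟨⟨?_, ?_⟩, mem_univ _⟩
    · linarith [Real.smoothTransition.le_one (2 * p.1 - 1 / 2)]
    · linarith [Real.smoothTransition.nonneg (2 * p.1 - 1 / 2)]

/-- If `g` is isotopic to `f`, the mapping tori of `g` and `f` are isomorphic over the circle: there
is an equivariant family of diffeomorphisms of the fibres of the infinite cyclic covers. -/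
theorem AreIsotopic.exists_equivariant_family (h : AreIsotopic g f) :
    ∃ ψ : ℝ → (M ≃ₘ⟮I, I⟯ M), ContMDiff (𝓘(ℝ, ℝ).prod I) I ∞ (fun p : ℝ × M => ψ p.1 p.2) ∧
      ∀ (t : ℝ) (k : ℤ) (x : M), ψ (t - k) (g.zpow k x) = f.zpow k (ψ t x) := by
  obtain ⟨Φ, hΦf, hΦg, hΦ⟩ := h.exists_flat
  -- The formula on `[n, n + 1)`. At `t = n` both `χ n` and `χ (n - 1)` equal `f⁻ⁿ gⁿ`, because `Φ`
  -- starts at `f` and ends at `g`.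
  let χ : ℤ → ℝ → (M ≃ₘ⟮I, I⟯ M) := fun n t =>
    ((g.zpow n).trans (Φ (t - n))).trans (f.zpow (-n - 1))
  have hχ : ∀ n t x, χ n t x = f.zpow (-n - 1) (Φ (t - n) (g.zpow n x)) := fun _ _ _ => rfl
  refine ⟨fun t => χ ⌊t⌋ t, ?_, fun t k x => ?_⟩
  · rintro ⟨t₀, x₀⟩
    set n := ⌊t₀⌋ with hn
    have hsm : ContMDiff (𝓘(ℝ, ℝ).prod I) I ∞ (fun p : ℝ × M => χ n p.1 p.2) := by
      have h1 : ContMDiff (𝓘(ℝ, ℝ).prod I) (𝓘(ℝ, ℝ).prod I) ∞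
          (fun p : ℝ × M => ((p.1 - n, g.zpow n p.2) : ℝ × M)) :=
        ((contDiff_id.sub contDiff_const).contMDiff.comp contMDiff_fst).prodMk
          ((g.zpow n).contMDiff.comp contMDiff_snd)
      exact (f.zpow (-n - 1)).contMDiff.comp (hΦ.comp h1)
    refine hsm.contMDiffAt.congr_of_eventuallyEq ?_
    -- On `(n - 1 / 4, n)` both isotopies are in their constant ranges, so `χ (n - 1)` and `χ n`
    -- agree there and the glued family is smooth at integers.
    have hmem : Ioo ((n : ℝ) - 1 / 4) (n + 1) ∈ 𝓝 t₀ :=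
      Ioo_mem_nhds (by linarith [Int.floor_le t₀]) (Int.lt_floor_add_one t₀)
    filter_upwards [continuous_fst.continuousAt.preimage_mem_nhds hmem]
    rintro ⟨t, x⟩ ⟨ht1, ht2⟩
    simp only at ht1 ht2 ⊢
    rcases le_or_gt (n : ℝ) t with ht | ht
    · rw [Int.floor_eq_iff.2 ⟨ht, ht2⟩]
    · have hfl : ⌊t⌋ = n - 1 := Int.floor_eq_iff.2 ⟨by push_cast; linarith, by push_cast; linarith⟩
      rw [hfl, hχ, hχ, hΦg _ (by push_cast; linarith), hΦf _ (by linarith)]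
      rw [← Diffeomorph.zpow_one_apply g (g.zpow _ _), ← Diffeomorph.zpow_add_apply,
        ← Diffeomorph.zpow_one_apply f (g.zpow _ _), ← Diffeomorph.zpow_add_apply f]
      congr 2
      · ring_nf
      · ring_nf
  · simp only
    rw [hχ, hχ, Int.floor_sub_intCast, ← Diffeomorph.zpow_add_apply,
      ← Diffeomorph.zpow_add_apply f]
    have h1 : t - k - ((⌊t⌋ - k : ℤ) : ℝ) = t - ⌊t⌋ := by push_cast; ring
    rw [h1]
    congr 2
    · ring
    · congr 3; ring

end Interpolation

/-! ### The symplectic form on the product of the circle with the mapping torus. -/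

section SymplecticCover

variable {E : Type*} [NormedAddCommGroup E] [NormedSpace ℝ E] {H : Type*} [TopologicalSpace H]
  {I : ModelWithCorners ℝ E H} {M : Type*} [TopologicalSpace M] [ChartedSpace H M]

/-- The two-form `ds ∧ dt + Ψ^* η` on `ℝ × (ℝ × M)`, for `Ψ (s, t, x) = ψ t x`. -/
def suspensionForm (η : TwoForm I M) (ψ : ℝ → M → M) :
    TwoForm (𝓘(ℝ, ℝ).prod (𝓘(ℝ, ℝ).prod I)) (ℝ × (ℝ × M)) := fun p =>
  TwoForm.pullback (𝓘(ℝ, ℝ).prod (𝓘(ℝ, ℝ).prod I)) 𝓘(ℝ, ℝ × ℝ)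
      (fun p : ℝ × (ℝ × M) => (p.1, p.2.1)) planeForm p +
    TwoForm.pullback (𝓘(ℝ, ℝ).prod (𝓘(ℝ, ℝ).prod I)) I
      (fun p : ℝ × (ℝ × M) => ψ p.2.1 p.2.2) η p

theorem contMDiff_planeProj : ContMDiff (𝓘(ℝ, ℝ).prod (𝓘(ℝ, ℝ).prod I)) 𝓘(ℝ, ℝ × ℝ) ∞
    (fun p : ℝ × (ℝ × M) => (p.1, p.2.1)) :=
  contMDiff_fst.prodMk_space (contMDiff_fst.comp contMDiff_snd)

theorem suspensionForm_apply (η : TwoForm I M) (ψ : ℝ → M → M) (p : ℝ × (ℝ × M))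
    (v w : TangentSpace (𝓘(ℝ, ℝ).prod (𝓘(ℝ, ℝ).prod I)) p) :
    suspensionForm η ψ p ![v, w] = (v.1 * w.2.1 - w.1 * v.2.1 : ℝ) +
      TwoForm.pullback (𝓘(ℝ, ℝ).prod (𝓘(ℝ, ℝ).prod I)) I
        (fun p : ℝ × (ℝ × M) => ψ p.2.1 p.2.2) η p ![v, w] := by
  have hd : HasMFDerivAt (𝓘(ℝ, ℝ).prod (𝓘(ℝ, ℝ).prod I)) 𝓘(ℝ, ℝ × ℝ)
      (fun p : ℝ × (ℝ × M) => (p.1, p.2.1)) p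
      ((ContinuousLinearMap.fst ℝ ℝ (ℝ × E)).prod
        ((ContinuousLinearMap.fst ℝ ℝ E).comp (ContinuousLinearMap.snd ℝ ℝ (ℝ × E)))) := by
    have h1 : HasMFDerivAt (𝓘(ℝ, ℝ).prod (𝓘(ℝ, ℝ).prod I)) 𝓘(ℝ, ℝ)
      (fun p : ℝ × (ℝ × M) => p.1) p (ContinuousLinearMap.fst ℝ ℝ (ℝ × E)) := hasMFDerivAt_fst p
    have h2 : HasMFDerivAt (𝓘(ℝ, ℝ).prod (𝓘(ℝ, ℝ).prod I)) 𝓘(ℝ, ℝ)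
      (fun p : ℝ × (ℝ × M) => p.2.1) p
      ((ContinuousLinearMap.fst ℝ ℝ E).comp (ContinuousLinearMap.snd ℝ ℝ (ℝ × E))) :=
      HasMFDerivAt.comp p (hasMFDerivAt_fst p.2) (hasMFDerivAt_snd p)
    exact ⟨h1.1.prodMk h2.1, h1.2.prodMk h2.2⟩
  refine congrArg (· + _) ((TwoForm.pullback_apply _ planeForm p v w).trans ?_)
  rw [hd.mfderiv]
  exact planeAreaForm_apply _ _

/-- Nondegeneracy: pairing `v` with vectors tangent to `M` gives `dΨ v = 0`, since the derivative of
`ψ t` is onto. Then the plane part annihilates the `s` and `t` components of `v`, and injectivity of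
that derivative the remaining one. -/
theorem isSymplecticForm_suspensionForm [FiniteDimensional ℝ E] [I.Boundaryless]
    [IsManifold I ∞ M] {η : TwoForm I M} (hη : IsSymplecticForm I η) {ψ : ℝ → (M ≃ₘ⟮I, I⟯ M)}
    (hψ : ContMDiff (𝓘(ℝ, ℝ).prod I) I ∞ (fun p : ℝ × M => ψ p.1 p.2)) :
    IsSymplecticForm (𝓘(ℝ, ℝ).prod (𝓘(ℝ, ℝ).prod I)) (suspensionForm η fun t => ψ t) := by
  rw [isSymplecticForm_iff] at hη ⊢
  have hΨ : ContMDiff (𝓘(ℝ, ℝ).prod (𝓘(ℝ, ℝ).prod I)) I ∞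
      (fun p : ℝ × (ℝ × M) => ψ p.2.1 p.2.2) := hψ.comp contMDiff_snd
  refine ⟨((isSmoothClosedForm_const planeAreaForm).pullback contMDiff_planeProj).add
    (hη.1.pullback hΨ), ?_⟩
  rintro ⟨s, t, x⟩ v hv
  simp only [suspensionForm_apply, TwoForm.pullback_apply] at hv
  set dΨ := mfderiv (𝓘(ℝ, ℝ).prod (𝓘(ℝ, ℝ).prod I)) I
    (fun p : ℝ × (ℝ × M) => ψ p.2.1 p.2.2) (s, t, x) with hdΨ
  have hι : ∀ ξ : TangentSpace I x, dΨ ((0, (0, ξ)) : ℝ × (ℝ × E)) = mfderiv I I (ψ t) x ξ := by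
    intro ξ
    have hd : HasMFDerivAt I (𝓘(ℝ, ℝ).prod (𝓘(ℝ, ℝ).prod I))
        (fun y : M => ((s, (t, y)) : ℝ × (ℝ × M))) x
        ((0 : E →L[ℝ] ℝ).prod ((0 : E →L[ℝ] ℝ).prod (ContinuousLinearMap.id ℝ E))) :=
      (hasMFDerivAt_const s x).prodMk ((hasMFDerivAt_const t x).prodMk (hasMFDerivAt_id x))
    have hc := ((hΨ.mdifferentiableAt (by simp) (x := (s, t, x))).hasMFDerivAt.comp x hd).mfderiv
    exact (DFunLike.congr_fun hc ξ).symm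
  have hb := (ψ t).isLocalDiffeomorph.bijective_mfderiv x
  have h1 : dΨ v = 0 := by
    refine hη.2 _ _ fun w => ?_
    obtain ⟨ξ, rfl⟩ := hb.2 w
    have h := hv ((0, (0, ξ)) : ℝ × (ℝ × E))
    rw [hι] at h
    have h0 : (v.1 * (0 : ℝ) - (0 : ℝ) * v.2.1 : ℝ) = 0 := by ring
    exact ((congrArg (· + _) h0).trans (zero_add _)).symm.trans h
  have h2 : ∀ w : ℝ × (ℝ × E), (v.1 * w.2.1 - w.1 * v.2.1 : ℝ) = 0 := by
    intro w
    have h := hv w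
    rw [h1] at h
    have h0 : η (ψ t x) ![0, dΨ w] = 0 := (η (ψ t x)).map_coord_zero 0 rfl
    exact ((congrArg (_ + ·) h0).trans (add_zero _)).symm.trans h
  have hs : (v.1 : ℝ) = 0 := by
    have h := h2 (0, (1, 0))
    simpa using h
  have ht : (v.2.1 : ℝ) = 0 := by
    have h := h2 (1, (0, 0))
    simpa using h
  have hv0 : v = ((0, (0, v.2.2)) : ℝ × (ℝ × E)) := Prod.ext hs (Prod.ext ht rfl)
  have hx : (v.2.2 : E) = 0 := by
    exact hb.1 (((hι _).symm.trans ((congrArg dΨ hv0.symm).trans h1)).trans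
      (map_zero (mfderiv I I (ψ t) x)).symm)
  rw [hv0, hx]
  rfl

/-- The cover `ℝ × (ℝ × M)` of the product of the circle with the mapping torus of `g`. -/
def mappingTorusCoverMap (g : M ≃ₘ⟮I, I⟯ M) : ℝ × (ℝ × M) → Circle × MappingTorus g :=
  Prod.map circleCover (mappingTorusProj g)

theorem mappingTorusCoverMap_surjective (g : M ≃ₘ⟮I, I⟯ M) :
    Function.Surjective (mappingTorusCoverMap g) :=
  circleCover_surjective.prodMap (mappingTorusProj_surjective g)

theorem isLocalDiffeomorph_mappingTorusCoverMap [T2Space M] [LocallyCompactSpace M]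
    [IsManifold I ∞ M] (g : M ≃ₘ⟮I, I⟯ M) :
    IsLocalDiffeomorph (𝓘(ℝ, ℝ).prod (𝓘(ℝ, ℝ).prod I)) ((𝓡 1).prod (𝓘(ℝ, ℝ).prod I)) ∞
      (mappingTorusCoverMap g) :=
  isLocalDiffeomorph_circleCover.prodMap (isLocalDiffeomorph_mappingTorusProj g)

/-- The deck transformations of `ℝ × (ℝ × M)`. -/
def mappingTorusDeck (g : M ≃ₘ⟮I, I⟯ M) (k n : ℤ) (p : ℝ × (ℝ × M)) : ℝ × (ℝ × M) :=
  (p.1 + k, (p.2.1 - n, g.zpow n p.2.2))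

theorem mappingTorusCoverMap_eq_iff (g : M ≃ₘ⟮I, I⟯ M) {p q : ℝ × (ℝ × M)} :
    mappingTorusCoverMap g p = mappingTorusCoverMap g q ↔
      ∃ k n : ℤ, mappingTorusDeck g k n p = q := by
  obtain ⟨s, t, x⟩ := p
  obtain ⟨s', t', x'⟩ := q
  simp only [mappingTorusCoverMap, Prod.map_apply, Prod.mk.injEq, mappingTorusDeck]
  rw [mappingTorusProj_eq_iff, eq_comm, circleCover_eq_iff]
  constructor
  · rintro ⟨⟨k, hk⟩, n, hn, hx⟩
    exact ⟨k, n, hk.symm, hn.symm, hx.symm⟩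
  · rintro ⟨k, n, hk, hn, hx⟩
    exact ⟨⟨k, hk.symm⟩, n, hn.symm, hx.symm⟩

theorem mappingTorusCoverMap_comp_deck (g : M ≃ₘ⟮I, I⟯ M) (k n : ℤ) :
    mappingTorusCoverMap g ∘ mappingTorusDeck g k n = mappingTorusCoverMap g :=
  funext fun _ => ((mappingTorusCoverMap_eq_iff g).2 ⟨k, n, rfl⟩).symm

theorem contMDiff_mappingTorusDeck (g : M ≃ₘ⟮I, I⟯ M) (k n : ℤ) :
    ContMDiff (𝓘(ℝ, ℝ).prod (𝓘(ℝ, ℝ).prod I)) (𝓘(ℝ, ℝ).prod (𝓘(ℝ, ℝ).prod I)) ∞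
      (mappingTorusDeck g k n) := by
  have h1 : ContMDiff 𝓘(ℝ, ℝ) 𝓘(ℝ, ℝ) ∞ (fun s : ℝ => s + k) :=
    (contDiff_id.add contDiff_const).contMDiff
  have h2 : ContMDiff 𝓘(ℝ, ℝ) 𝓘(ℝ, ℝ) ∞ (fun s : ℝ => s - n) :=
    (contDiff_id.sub contDiff_const).contMDiff
  exact h1.prodMap (h2.prodMap (g.zpow n).contMDiff)

/-- A deck transformation translates the plane, and equivariance turns it into a power of `f` after
applying `Ψ`; both leave the corresponding summand unchanged. -/
theorem pullback_deck_suspensionForm {η : TwoForm I M} {f g : M ≃ₘ⟮I, I⟯ M}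
    (hf : PreservesForm I η f) {ψ : ℝ → (M ≃ₘ⟮I, I⟯ M)}
    (hψ : ContMDiff (𝓘(ℝ, ℝ).prod I) I ∞ (fun p : ℝ × M => ψ p.1 p.2))
    (hψk : ∀ (t : ℝ) (k : ℤ) (x : M), ψ (t - k) (g.zpow k x) = f.zpow k (ψ t x)) (k n : ℤ) :
    TwoForm.pullback (𝓘(ℝ, ℝ).prod (𝓘(ℝ, ℝ).prod I)) (𝓘(ℝ, ℝ).prod (𝓘(ℝ, ℝ).prod I))
      (mappingTorusDeck g k n) (suspensionForm η fun t => ψ t) = suspensionForm η fun t => ψ t := by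
  have hΨ : ContMDiff (𝓘(ℝ, ℝ).prod (𝓘(ℝ, ℝ).prod I)) I ∞
      (fun p : ℝ × (ℝ × M) => ψ p.2.1 p.2.2) := hψ.comp contMDiff_snd
  have hD := contMDiff_mappingTorusDeck g k n
  funext p
  have e1 : TwoForm.pullback (𝓘(ℝ, ℝ).prod (𝓘(ℝ, ℝ).prod I)) (𝓘(ℝ, ℝ).prod (𝓘(ℝ, ℝ).prod I))
      (mappingTorusDeck g k n) (TwoForm.pullback (𝓘(ℝ, ℝ).prod (𝓘(ℝ, ℝ).prod I)) I
        (fun p : ℝ × (ℝ × M) => ψ p.2.1 p.2.2) η) p =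
      TwoForm.pullback (𝓘(ℝ, ℝ).prod (𝓘(ℝ, ℝ).prod I)) I
        (fun p : ℝ × (ℝ × M) => ψ p.2.1 p.2.2) η p := by
    rw [← TwoForm.pullback_comp η (hΨ.mdifferentiable (by simp) _)
      (hD.mdifferentiable (by simp) _)]
    have h : (fun p : ℝ × (ℝ × M) => ψ p.2.1 p.2.2) ∘ mappingTorusDeck g k n =
        f.zpow n ∘ fun p : ℝ × (ℝ × M) => ψ p.2.1 p.2.2 := funext fun p => hψk _ _ _
    rw [h, TwoForm.pullback_comp η ((f.zpow n).mdifferentiable (by simp) _)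
      (hΨ.mdifferentiable (by simp) _), preservesForm_iff.1 (hf.zpow n)]
  have e2 : TwoForm.pullback (𝓘(ℝ, ℝ).prod (𝓘(ℝ, ℝ).prod I)) (𝓘(ℝ, ℝ).prod (𝓘(ℝ, ℝ).prod I))
      (mappingTorusDeck g k n) (TwoForm.pullback (𝓘(ℝ, ℝ).prod (𝓘(ℝ, ℝ).prod I)) 𝓘(ℝ, ℝ × ℝ)
        (fun p : ℝ × (ℝ × M) => (p.1, p.2.1)) planeForm) p =
      TwoForm.pullback (𝓘(ℝ, ℝ).prod (𝓘(ℝ, ℝ).prod I)) 𝓘(ℝ, ℝ × ℝ)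
        (fun p : ℝ × (ℝ × M) => (p.1, p.2.1)) planeForm p := by
    let T : ℝ × ℝ → ℝ × ℝ := fun y => y + ((k : ℝ), -(n : ℝ))
    have hT : ∀ y, HasMFDerivAt 𝓘(ℝ, ℝ × ℝ) 𝓘(ℝ, ℝ × ℝ) T y (ContinuousLinearMap.id ℝ (ℝ × ℝ)) :=
      fun y => ((hasFDerivAt_id y).add_const _).hasMFDerivAt
    rw [← TwoForm.pullback_comp planeForm (contMDiff_planeProj.mdifferentiable (by simp) _)
      (hD.mdifferentiable (by simp) _)]
    have h : (fun p : ℝ × (ℝ × M) => (p.1, p.2.1)) ∘ mappingTorusDeck g k n =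
        T ∘ fun p : ℝ × (ℝ × M) => (p.1, p.2.1) := rfl
    rw [h, TwoForm.pullback_comp planeForm (hT _).mdifferentiableAt
      (contMDiff_planeProj.mdifferentiable (by simp) _)]
    congr 1
    funext y
    refine TwoForm.ext_apply fun v w => ?_
    rw [TwoForm.pullback_apply, (hT y).mfderiv]
    rfl
  refine TwoForm.ext_apply fun v w => ?_
  have e1' := DFunLike.congr_fun e1 ![v, w]
  have e2' := DFunLike.congr_fun e2 ![v, w]
  rw [TwoForm.pullback_apply] at e1' e2' ⊢
  exact congrArg₂ (· + ·) e2' e1'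

/-- If `g` is isotopic to a symplectomorphism, then the product of the circle with the mapping torus
of `g` is symplectic. -/
theorem AreIsotopic.exists_isSymplecticForm [FiniteDimensional ℝ E] [I.Boundaryless] [T2Space M]
    [LocallyCompactSpace M] [IsManifold I ∞ M] {η : TwoForm I M} (hη : IsSymplecticForm I η)
    {f g : M ≃ₘ⟮I, I⟯ M} (hf : PreservesForm I η f) (h : AreIsotopic g f) :
    ∃ σ : TwoForm ((𝓡 1).prod (𝓘(ℝ, ℝ).prod I)) (Circle × MappingTorus g),
      IsSymplecticForm ((𝓡 1).prod (𝓘(ℝ, ℝ).prod I)) σ := by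
  obtain ⟨ψ, hψ, hψk⟩ := h.exists_equivariant_family
  obtain ⟨σ, hσ⟩ := TwoForm.exists_pullback_eq (isLocalDiffeomorph_mappingTorusCoverMap g)
    (mappingTorusCoverMap_surjective g) (suspensionForm η fun t => ψ t) fun p q hpq => by
      obtain ⟨k, n, rfl⟩ := (mappingTorusCoverMap_eq_iff g).1 hpq
      exact ⟨mappingTorusDeck g k n, (contMDiff_mappingTorusDeck g k n).mdifferentiable (by simp),
        rfl, mappingTorusCoverMap_comp_deck g k n, pullback_deck_suspensionForm hf hψ hψk k n⟩
  refine ⟨σ, IsSymplecticForm.of_pullback (isLocalDiffeomorph_mappingTorusCoverMap g)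
    (mappingTorusCoverMap_surjective g) ?_⟩
  rw [hσ]
  exact isSymplecticForm_suspensionForm hη hψ

end SymplecticCover

/-! ### The circle action by the suspension flow, and its isotropy groups. -/

section CircleAction

variable {E : Type*} [NormedAddCommGroup E] [NormedSpace ℝ E] {H : Type*} [TopologicalSpace H]
  {I : ModelWithCorners ℝ E H} {M : Type*} [TopologicalSpace M] [ChartedSpace H M]
  (g : M ≃ₘ⟮I, I⟯ M)

/-- The suspension flow on the mapping torus, `[t, x] ↦ [t + u, x]`. -/
def mappingTorusFlow (u : ℝ) : MappingTorus g → MappingTorus g :=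
  Quotient.lift (fun p : ℝ × M => mappingTorusProj g (p.1 + u, p.2)) fun p q hpq => by
    obtain ⟨t, x⟩ := p
    obtain ⟨t', x'⟩ := q
    have h : mappingTorusProj g (t, x) = mappingTorusProj g (t', x') := Quotient.sound hpq
    obtain ⟨n, rfl, rfl⟩ := (mappingTorusProj_eq_iff g).1 h
    exact (mappingTorusProj_eq_iff g).2 ⟨n, by ring, rfl⟩

theorem mappingTorusFlow_proj (u t : ℝ) (x : M) :
    mappingTorusFlow g u (mappingTorusProj g (t, x)) = mappingTorusProj g (t + u, x) := rfl

theorem mappingTorusFlow_add (u v : ℝ) (p : MappingTorus g) :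
    mappingTorusFlow g (u + v) p = mappingTorusFlow g u (mappingTorusFlow g v p) := by
  obtain ⟨⟨t, x⟩, rfl⟩ := mappingTorusProj_surjective g p
  simp only [mappingTorusFlow_proj]
  congr 2
  ring

theorem mappingTorusFlow_zero (p : MappingTorus g) : mappingTorusFlow g 0 p = p := by
  obtain ⟨⟨t, x⟩, rfl⟩ := mappingTorusProj_surjective g p
  rw [mappingTorusFlow_proj, add_zero]

variable {g} {r : ℕ}

theorem Diffeomorph.zpow_mul_apply_of_periodic (hg : ∀ x, g.zpow r x = x) (n : ℤ) (x : M) :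
    g.zpow (r * n) x = x := by
  have h : (g.toEquiv : Equiv.Perm M) ^ (r : ℤ) = 1 := Equiv.ext hg
  change ((g.toEquiv : Equiv.Perm M) ^ (r * n : ℤ)) x = x
  rw [_root_.zpow_mul, h, _root_.one_zpow]
  rfl

/-- Shifting `t` by `r n` amounts to applying `g ^ (r n) = 1` to `x`. -/
theorem mappingTorusFlow_mul_of_periodic (hg : ∀ x, g.zpow r x = x) (n : ℤ)
    (p : MappingTorus g) : mappingTorusFlow g (r * n) p = p := by
  obtain ⟨⟨t, x⟩, rfl⟩ := mappingTorusProj_surjective g p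
  rw [mappingTorusFlow_proj, mappingTorusProj_eq_iff]
  exact ⟨r * n, by push_cast; ring, (Diffeomorph.zpow_mul_apply_of_periodic hg n x).symm⟩

/-- The circle rotates the mapping torus of a diffeomorphism of order `r`, along the suspension
flow, `r` times. -/
def suspensionSMul (g : M ≃ₘ⟮I, I⟯ M) (r : ℕ) (z : Circle) (y : Circle × MappingTorus g) :
    Circle × MappingTorus g :=
  (y.1, mappingTorusFlow g (r * Function.surjInv circleCover_surjective z) y.2)

/-- Two logarithms of an element of the circle differ by an integer `n`, and the flow for time `r n`
is trivial; so the choice in the definition is immaterial. -/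
theorem suspensionSMul_circleCover (hg : ∀ x, g.zpow r x = x) (u : ℝ)
    (y : Circle × MappingTorus g) :
    suspensionSMul g r (circleCover u) y = (y.1, mappingTorusFlow g (r * u) y.2) := by
  obtain ⟨n, hn⟩ := circleCover_eq_iff.1 (Function.surjInv_eq circleCover_surjective (circleCover u))
  rw [suspensionSMul, hn, mul_add, mappingTorusFlow_add, mappingTorusFlow_mul_of_periodic hg]

/-- The action of the circle on the product of the circle with the mapping torus of a diffeomorphism
of order `r`. -/
@[reducible]
def suspensionAction (hg : ∀ x, g.zpow r x = x) : MulAction Circle (Circle × MappingTorus g) where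
  smul := suspensionSMul g r
  one_smul y := by
    change suspensionSMul g r 1 y = y
    have h : (1 : Circle) = circleCover 0 := by simp [circleCover]
    rw [h, suspensionSMul_circleCover hg, mul_zero, mappingTorusFlow_zero]
  mul_smul z w y := by
    obtain ⟨u, rfl⟩ := circleCover_surjective z
    obtain ⟨v, rfl⟩ := circleCover_surjective w
    change suspensionSMul g r _ y = suspensionSMul g r _ (suspensionSMul g r _ y)
    rw [← circleCover_add]
    simp only [suspensionSMul_circleCover hg, mul_add, mappingTorusFlow_add]

theorem suspensionSMul_cover (hg : ∀ x, g.zpow r x = x) (u : ℝ) (p : ℝ × (ℝ × M)) :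
    suspensionSMul g r (circleCover u) (mappingTorusCoverMap g p) =
      mappingTorusCoverMap g (p.1, (p.2.1 + r * u, p.2.2)) :=
  suspensionSMul_circleCover hg u _

/-- The chosen logarithm is not continuous, so smoothness is checked on the cover, where the action
lifts to `(u, s, t, x) ↦ (s, t + r u, x)`. -/
theorem contMDiff_suspensionSMul [T2Space M] [LocallyCompactSpace M] [IsManifold I ∞ M]
    (hg : ∀ x, g.zpow r x = x) :
    ContMDiff ((𝓡 1).prod ((𝓡 1).prod (𝓘(ℝ, ℝ).prod I))) ((𝓡 1).prod (𝓘(ℝ, ℝ).prod I)) ∞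
      (fun q : Circle × (Circle × MappingTorus g) => suspensionSMul g r q.1 q.2) := by
  refine ContMDiff.of_comp_isLocalDiffeomorph
    (isLocalDiffeomorph_circleCover.prodMap (isLocalDiffeomorph_mappingTorusCoverMap g))
    (circleCover_surjective.prodMap (mappingTorusCoverMap_surjective g)) ?_
  let A : ℝ × (ℝ × (ℝ × M)) → ℝ × (ℝ × M) := fun q => (q.2.1, (q.2.2.1 + r * q.1, q.2.2.2))
  have hA : ContMDiff (𝓘(ℝ, ℝ).prod (𝓘(ℝ, ℝ).prod (𝓘(ℝ, ℝ).prod I)))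
      (𝓘(ℝ, ℝ).prod (𝓘(ℝ, ℝ).prod I)) ∞ A := by
    have h1 : ContMDiff (𝓘(ℝ, ℝ).prod (𝓘(ℝ, ℝ).prod (𝓘(ℝ, ℝ).prod I))) 𝓘(ℝ, ℝ) ∞
        (fun q : ℝ × (ℝ × (ℝ × M)) => q.2.2.1) :=
      contMDiff_fst.comp (contMDiff_snd.comp contMDiff_snd)
    have h2 : ContMDiff (𝓘(ℝ, ℝ).prod (𝓘(ℝ, ℝ).prod (𝓘(ℝ, ℝ).prod I))) 𝓘(ℝ, ℝ) ∞
        (fun q : ℝ × (ℝ × (ℝ × M)) => (r : ℝ) * q.1) :=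
      (contDiff_const.mul contDiff_id).contMDiff.comp contMDiff_fst
    have h3 : ContMDiff (𝓘(ℝ, ℝ).prod (𝓘(ℝ, ℝ).prod (𝓘(ℝ, ℝ).prod I))) 𝓘(ℝ, ℝ) ∞
        (fun q : ℝ × (ℝ × (ℝ × M)) => q.2.2.1 + (r : ℝ) * q.1) := h1.add h2
    exact (contMDiff_fst.comp contMDiff_snd).prodMk
      (h3.prodMk (contMDiff_snd.comp (contMDiff_snd.comp contMDiff_snd)))
  have h : (fun q : Circle × (Circle × MappingTorus g) => suspensionSMul g r q.1 q.2) ∘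
      Prod.map circleCover (mappingTorusCoverMap g) = mappingTorusCoverMap g ∘ A :=
    funext fun q => suspensionSMul_cover hg q.1 q.2
  rw [h]
  exact (isLocalDiffeomorph_mappingTorusCoverMap g).contMDiff.comp hA

theorem suspensionSMul_cover_eq_iff (hg : ∀ x, g.zpow r x = x) (u : ℝ) (p : ℝ × (ℝ × M)) :
    suspensionSMul g r (circleCover u) (mappingTorusCoverMap g p) = mappingTorusCoverMap g p ↔
      ∃ n : ℤ, r * u = n ∧ g.zpow n p.2.2 = p.2.2 := by
  obtain ⟨s, t, x⟩ := p
  rw [suspensionSMul_cover hg, mappingTorusCoverMap, Prod.map_apply, Prod.map_apply, Prod.mk.injEq,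
    mappingTorusProj_eq_iff]
  simp only [true_and]
  refine exists_congr fun n => and_congr ⟨fun h => by linarith, fun h => by linarith⟩ eq_comm

theorem fixedPoints_suspensionAction [NeZero r] (hg : ∀ x, g.zpow r x = x) :
    letI := suspensionAction hg
    MulAction.fixedPoints Circle (Circle × MappingTorus g) = ∅ := by
  refine eq_empty_of_forall_notMem fun y hy => ?_
  obtain ⟨p, rfl⟩ := mappingTorusCoverMap_surjective g y
  -- This element flows for time `1 / 2`, which is not an integer.
  obtain ⟨n, hn, -⟩ := (suspensionSMul_cover_eq_iff hg (1 / (2 * r)) p).1 (hy _)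
  have hr : (r : ℝ) ≠ 0 := Nat.cast_ne_zero.2 (NeZero.ne r)
  have h1 : (2 * n : ℤ) = 1 := by
    have h2 : (2 * n : ℝ) = 1 := by rw [← hn]; field_simp
    exact_mod_cast h2
  omega

/-- Every stabilizer consists of `r`-th roots of unity. It contains the generator `exp (2πi/r)`, the
flow for time `1`, exactly when `g` fixes `x`. -/
theorem stabilizer_suspensionAction_eq_iff [NeZero r] (hg : ∀ x, g.zpow r x = x)
    (p : ℝ × (ℝ × M)) :
    letI := suspensionAction hg
    MulAction.stabilizer Circle (mappingTorusCoverMap g p) = circleCyclicSubgroup r ↔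
      g p.2.2 = p.2.2 := by
  let _ := suspensionAction hg
  have hr : (r : ℝ) ≠ 0 := Nat.cast_ne_zero.2 (NeZero.ne r)
  have hC : ∀ u : ℝ, circleCover u ∈ circleCyclicSubgroup r ↔ ∃ n : ℤ, r * u = n := by
    intro u
    have h1 : circleCover u ^ r = circleCover (r * u) := by
      rw [circleCover, circleCover, ← Circle.exp_nsmul, nsmul_eq_mul]
      congr 1
      ring
    have h2 : (1 : Circle) = circleCover 0 := by simp [circleCover]
    change circleCover u ^ r = 1 ↔ _
    rw [h1, h2, circleCover_eq_iff]
    simp only [zero_add]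
  have hS : ∀ u : ℝ, circleCover u ∈ MulAction.stabilizer Circle (mappingTorusCoverMap g p) ↔
      ∃ n : ℤ, r * u = n ∧ g.zpow n p.2.2 = p.2.2 := fun u => suspensionSMul_cover_eq_iff hg u p
  constructor
  · intro h
    have h1 : circleCover (1 / r) ∈ circleCyclicSubgroup r := (hC _).2 ⟨1, by field_simp; norm_num⟩
    rw [← h, hS] at h1
    obtain ⟨n, hn, hx⟩ := h1
    have h2 : n = 1 := by
      have h3 : (n : ℝ) = 1 := by rw [← hn]; field_simp
      exact_mod_cast h3
    rwa [h2, Diffeomorph.zpow_one_apply] at hx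
  · intro h
    ext z
    obtain ⟨u, rfl⟩ := circleCover_surjective z
    rw [hC, hS]
    refine exists_congr fun n => ⟨fun h => h.1, fun h' => ⟨h', ?_⟩⟩
    exact Equiv.Perm.zpow_apply_eq_self_of_apply_eq_self (f := (g.toEquiv : Equiv.Perm M)) h n

end CircleAction

/-! ### The isotropy set as a product of the torus with the fixed point set. -/

section TorusCover

section

variable {M : Type*}

variable (M) in
/-- The cover `ℝ × (ℝ × M)` of the product of the torus with `M`. -/
def torusCoverMap : ℝ × (ℝ × M) → Circle × (Circle × M) :=
  Prod.map circleCover (Prod.map circleCover id)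

theorem torusCoverMap_surjective : Function.Surjective (torusCoverMap M) :=
  circleCover_surjective.prodMap (circleCover_surjective.prodMap Function.surjective_id)

/-- Translations of `ℝ × (ℝ × M)`. -/
def coverTranslation (a b : ℝ) (p : ℝ × (ℝ × M)) : ℝ × (ℝ × M) := (p.1 + a, (p.2.1 + b, p.2.2))

theorem torusCoverMap_eq_iff {p q : ℝ × (ℝ × M)} :
    torusCoverMap M p = torusCoverMap M q ↔ ∃ k n : ℤ, coverTranslation k n p = q := by
  obtain ⟨s, t, x⟩ := p
  obtain ⟨s', t', x'⟩ := q
  simp only [torusCoverMap, Prod.map_apply, Prod.mk.injEq, coverTranslation, id]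
  rw [eq_comm, circleCover_eq_iff, eq_comm, circleCover_eq_iff]
  constructor
  · rintro ⟨⟨k, hk⟩, ⟨n, hn⟩, hx⟩
    exact ⟨k, n, hk.symm, hn.symm, hx⟩
  · rintro ⟨k, n, hk, hn, hx⟩
    exact ⟨⟨k, hk.symm⟩, ⟨n, hn.symm⟩, hx⟩

end

variable {E : Type*} [NormedAddCommGroup E] [NormedSpace ℝ E] {H : Type*} [TopologicalSpace H]
  {I : ModelWithCorners ℝ E H} {M : Type*} [TopologicalSpace M] [ChartedSpace H M]

theorem isLocalDiffeomorph_torusCoverMap :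
    IsLocalDiffeomorph (𝓘(ℝ, ℝ).prod (𝓘(ℝ, ℝ).prod I)) ((𝓡 1).prod ((𝓡 1).prod I)) ∞
      (torusCoverMap M) :=
  isLocalDiffeomorph_circleCover.prodMap
    (isLocalDiffeomorph_circleCover.prodMap IsLocalDiffeomorph.id)

theorem contMDiff_coverTranslation (a b : ℝ) :
    ContMDiff (𝓘(ℝ, ℝ).prod (𝓘(ℝ, ℝ).prod I)) (𝓘(ℝ, ℝ).prod (𝓘(ℝ, ℝ).prod I)) ∞
      (coverTranslation (M := M) a b) := by
  have h : ∀ a : ℝ, ContMDiff 𝓘(ℝ, ℝ) 𝓘(ℝ, ℝ) ∞ (fun s : ℝ => s + a) :=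
    fun a => (contDiff_id.add contDiff_const).contMDiff
  exact (h a).prodMap ((h b).prodMap contMDiff_id)

variable {g : M ≃ₘ⟮I, I⟯ M} {r : ℕ}

/-- Where `g x = x`, deck transformations of the mapping torus do not move `x` and are integer
translations in `t`. Both covers thus have the same fibres there. -/
theorem areDiffeomorphicSubsets_stabilizer [T2Space M] [LocallyCompactSpace M] [IsManifold I ∞ M]
    [NeZero r] (hg : ∀ x, g.zpow r x = x) :
    letI := suspensionAction hg
    AreDiffeomorphicSubsets ((𝓡 1).prod (𝓘(ℝ, ℝ).prod I)) ((𝓡 1).prod ((𝓡 1).prod I))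
      {y : Circle × MappingTorus g | MulAction.stabilizer Circle y = circleCyclicSubgroup r}
      ((univ : Set Circle) ×ˢ ((univ : Set Circle) ×ˢ {x | g x = x})) := by
  let _ := suspensionAction hg
  refine areDiffeomorphicSubsets_of_cover (isLocalDiffeomorph_mappingTorusCoverMap g)
    (mappingTorusCoverMap_surjective g) isLocalDiffeomorph_torusCoverMap torusCoverMap_surjective
    (fun p => ?_) fun p q hp _ => ?_
  · refine (stabilizer_suspensionAction_eq_iff hg p).trans ?_
    simp [torusCoverMap]
  · have hx : g p.2.2 = p.2.2 := (stabilizer_suspensionAction_eq_iff hg p).1 hp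
    have hx' : ∀ n, g.zpow n p.2.2 = p.2.2 :=
      Equiv.Perm.zpow_apply_eq_self_of_apply_eq_self (f := (g.toEquiv : Equiv.Perm M)) hx
    rw [mappingTorusCoverMap_eq_iff, torusCoverMap_eq_iff]
    refine exists_congr fun k => ?_
    simp only [mappingTorusDeck, hx', coverTranslation]
    constructor
    · rintro ⟨n, rfl⟩
      -- The sign changes because `n` acts on the cover of the mapping torus by `t ↦ t - n`.
      exact ⟨-n, by push_cast; rw [sub_eq_add_neg]⟩
    · rintro ⟨n, rfl⟩
      exact ⟨-n, by push_cast; rw [sub_neg_eq_add]⟩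

end TorusCover

/-! ### Consequences of an invariant symplectic form. -/

section Invariant

variable {E : Type*} [NormedAddCommGroup E] [NormedSpace ℝ E] [FiniteDimensional ℝ E] {H : Type*}
  [TopologicalSpace H] {I : ModelWithCorners ℝ E H} [I.Boundaryless]
  {M : Type u} [TopologicalSpace M] [ChartedSpace H M]
  [T2Space M] [LocallyCompactSpace M] [IsManifold I ∞ M] {g : M ≃ₘ⟮I, I⟯ M} {r : ℕ}

theorem isSymplecticSubset_of_invariant [NeZero r] (hg : ∀ x, g.zpow r x = x)
    {σ : TwoForm ((𝓡 1).prod (𝓘(ℝ, ℝ).prod I)) (Circle × MappingTorus g)}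
    (hσ : IsSymplecticForm ((𝓡 1).prod (𝓘(ℝ, ℝ).prod I)) σ)
    (hinv : ∀ z, PreservesForm ((𝓡 1).prod (𝓘(ℝ, ℝ).prod I)) σ (suspensionSMul g r z)) :
    IsSymplecticSubset ((𝓡 1).prod ((𝓡 1).prod I))
      ((univ : Set Circle) ×ˢ ((univ : Set Circle) ×ˢ {x | g x = x})) := by
  have hr : (r : ℝ) ≠ 0 := Nat.cast_ne_zero.2 (NeZero.ne r)
  have hπ := isLocalDiffeomorph_mappingTorusCoverMap g
  have hπ' := isLocalDiffeomorph_torusCoverMap (I := I) (M := M)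
  set τ := TwoForm.pullback (𝓘(ℝ, ℝ).prod (𝓘(ℝ, ℝ).prod I)) ((𝓡 1).prod (𝓘(ℝ, ℝ).prod I))
    (mappingTorusCoverMap g) σ with hτ
  have hτs : IsSymplecticForm (𝓘(ℝ, ℝ).prod (𝓘(ℝ, ℝ).prod I)) τ := hσ.pullback hπ
  -- Every smooth map of the cover that lifts an element of the circle preserves the lifted form. It
  -- is used for integer translations and for `id × id × g`.
  have hlift : ∀ (A : ℝ × (ℝ × M) → ℝ × (ℝ × M)) (z : Circle),
      ContMDiff (𝓘(ℝ, ℝ).prod (𝓘(ℝ, ℝ).prod I)) (𝓘(ℝ, ℝ).prod (𝓘(ℝ, ℝ).prod I)) ∞ A →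
      (∀ p, mappingTorusCoverMap g (A p) = suspensionSMul g r z (mappingTorusCoverMap g p)) →
      TwoForm.pullback (𝓘(ℝ, ℝ).prod (𝓘(ℝ, ℝ).prod I)) (𝓘(ℝ, ℝ).prod (𝓘(ℝ, ℝ).prod I)) A τ = τ := by
    intro A z hA hAz
    have hz : ContMDiff ((𝓡 1).prod (𝓘(ℝ, ℝ).prod I)) ((𝓡 1).prod (𝓘(ℝ, ℝ).prod I)) ∞
        (suspensionSMul g r z) :=
      (contMDiff_suspensionSMul hg).comp (contMDiff_const.prodMk contMDiff_id)
    funext p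
    rw [hτ, ← TwoForm.pullback_comp σ (hπ.contMDiff.mdifferentiable (by simp) _)
      (hA.mdifferentiable (by simp) _)]
    have h : mappingTorusCoverMap g ∘ A = suspensionSMul g r z ∘ mappingTorusCoverMap g :=
      funext hAz
    rw [h, TwoForm.pullback_comp σ (hz.mdifferentiable (by simp) _)
      (hπ.contMDiff.mdifferentiable (by simp) _), preservesForm_iff.1 (hinv z)]
  obtain ⟨ρ, hρ⟩ := TwoForm.exists_pullback_eq hπ' torusCoverMap_surjective τ fun p q hpq => by
    obtain ⟨k, n, rfl⟩ := torusCoverMap_eq_iff.1 hpq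
    refine ⟨coverTranslation k n, (contMDiff_coverTranslation _ _).mdifferentiable (by simp), rfl,
      funext fun p => (torusCoverMap_eq_iff.2 ⟨k, n, rfl⟩).symm,
      -- This element flows for time `r · (n / r) = n`; the translation by `k` in the first factor
      -- is a deck transformation.
      hlift _ (circleCover (n / r)) (contMDiff_coverTranslation _ _) fun p => ?_⟩
    rw [suspensionSMul_cover hg, mul_div_cancel₀ _ hr]
    exact ((mappingTorusCoverMap_eq_iff g).2 ⟨k, 0, by
      simp [mappingTorusDeck, coverTranslation, Diffeomorph.zpow_zero_apply]⟩).symm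
  have hρs : IsSymplecticForm ((𝓡 1).prod ((𝓡 1).prod I)) ρ :=
    IsSymplecticForm.of_pullback hπ' torusCoverMap_surjective (by rwa [hρ])
  let a : Circle × (Circle × M) → Circle × (Circle × M) := Prod.map id (Prod.map id g)
  let A : ℝ × (ℝ × M) → ℝ × (ℝ × M) := Prod.map id (Prod.map id g)
  have ha : ContMDiff ((𝓡 1).prod ((𝓡 1).prod I)) ((𝓡 1).prod ((𝓡 1).prod I)) ∞ a :=
    contMDiff_id.prodMap (contMDiff_id.prodMap g.contMDiff)
  have hA : ContMDiff (𝓘(ℝ, ℝ).prod (𝓘(ℝ, ℝ).prod I)) (𝓘(ℝ, ℝ).prod (𝓘(ℝ, ℝ).prod I)) ∞ A :=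
    contMDiff_id.prodMap (contMDiff_id.prodMap g.contMDiff)
  -- Flowing for time `1` is applying `g` to the fibre, since `(t + 1, x) ∼ (t, g x)`.
  have hAτ := hlift A (circleCover (1 / r)) hA fun p => by
    rw [suspensionSMul_cover hg, mul_div_cancel₀ _ hr]
    refine ((mappingTorusCoverMap_eq_iff g).2 ⟨0, 1, ?_⟩).symm
    simp [mappingTorusDeck, A, Diffeomorph.zpow_one_apply, Prod.map]
  have haρ : PreservesForm ((𝓡 1).prod ((𝓡 1).prod I)) ρ a := by
    rw [preservesForm_iff]
    refine TwoForm.pullback_injective hπ' torusCoverMap_surjective ?_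
    funext p
    rw [← TwoForm.pullback_comp ρ (ha.mdifferentiable (by simp) _)
      (hπ'.contMDiff.mdifferentiable (by simp) _)]
    have h : a ∘ torusCoverMap M = torusCoverMap M ∘ A := rfl
    rw [h, TwoForm.pullback_comp ρ (hπ'.contMDiff.mdifferentiable (by simp) _)
      (hA.mdifferentiable (by simp) _), hρ, hAτ]
  have har : a^[r] = id := by
    have h1 : (⇑g)^[r] = id := by
      have h2 : (g.toEquiv : Equiv.Perm M) ^ r = 1 :=
        Equiv.ext fun x => by rw [← zpow_natCast]; exact hg x
      have h3 := Equiv.Perm.iterate_eq_pow (g.toEquiv : Equiv.Perm M) r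
      rw [h2] at h3
      exact h3
    simp only [a, Prod.map_iterate, h1]
    simp
  have hset : {y | a y = y} = (univ : Set Circle) ×ˢ ((univ : Set Circle) ×ˢ {x | g x = x}) := by
    ext ⟨z, w, x⟩
    simp [a]
  rw [← hset]
  exact isSymplecticSubset_fixedPoints ha (NeZero.ne r) har hρs haρ

end Invariant

end

theorem proposition4p2 {m r : ℕ} [NeZero r]
    {M : Type u} [TopologicalSpace M] [T2Space M] [CompactSpace M]
    [ChartedSpace (EuclideanSpace ℝ (Fin m)) M] [IsManifold (𝓡 m) ∞ M]
    (η : TwoForm (𝓡 m) M) (hη : IsSymplecticForm (𝓡 m) η)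
    [MulAction (Multiplicative (ZMod r)) M]
    (hsmooth : ∀ a : Multiplicative (ZMod r), ContMDiff (𝓡 m) (𝓡 m) ∞ (fun x : M => a • x))
    (hF : (MulAction.fixedPoints (Multiplicative (ZMod r)) M).Nonempty)
    (γ : Multiplicative (ZMod r)) (hγ : Subgroup.zpowers γ = ⊤)
    (f : M ≃ₘ⟮𝓡 m, 𝓡 m⟯ M) (hf : PreservesForm (𝓡 m) η f)
    (hiso : AreIsotopic (smulDiffeomorph hsmooth γ) f) :
    (∃ σ : TwoForm ((𝓡 1).prod (𝓘(ℝ, ℝ).prod (𝓡 m)))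
        (Circle × MappingTorus (smulDiffeomorph hsmooth γ)),
      IsSymplecticForm ((𝓡 1).prod (𝓘(ℝ, ℝ).prod (𝓡 m))) σ) ∧
    ∃ _ : MulAction Circle (Circle × MappingTorus (smulDiffeomorph hsmooth γ)),
      ContMDiffSMul (𝓡 1) ((𝓡 1).prod (𝓘(ℝ, ℝ).prod (𝓡 m))) ∞ Circle
        (Circle × MappingTorus (smulDiffeomorph hsmooth γ)) ∧
      MulAction.fixedPoints Circle (Circle × MappingTorus (smulDiffeomorph hsmooth γ)) = ∅ ∧
      AreDiffeomorphicSubsets ((𝓡 1).prod (𝓘(ℝ, ℝ).prod (𝓡 m)))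
        ((𝓡 1).prod ((𝓡 1).prod (𝓡 m)))
        {y : Circle × MappingTorus (smulDiffeomorph hsmooth γ) |
          MulAction.stabilizer Circle y = circleCyclicSubgroup r}
        ((univ : Set Circle) ×ˢ ((univ : Set Circle) ×ˢ
          MulAction.fixedPoints (Multiplicative (ZMod r)) M)) ∧
      (¬ IsSymplecticSubset ((𝓡 1).prod ((𝓡 1).prod (𝓡 m)))
          ((univ : Set Circle) ×ˢ ((univ : Set Circle) ×ˢ
            MulAction.fixedPoints (Multiplicative (ZMod r)) M)) →
        ¬ ∃ σ : TwoForm ((𝓡 1).prod (𝓘(ℝ, ℝ).prod (𝓡 m)))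
            (Circle × MappingTorus (smulDiffeomorph hsmooth γ)),
          IsSymplecticForm ((𝓡 1).prod (𝓘(ℝ, ℝ).prod (𝓡 m))) σ ∧
          ∀ z : Circle, PreservesForm ((𝓡 1).prod (𝓘(ℝ, ℝ).prod (𝓡 m))) σ
            (fun y : Circle × MappingTorus (smulDiffeomorph hsmooth γ) => z • y)) := by
  set g := smulDiffeomorph hsmooth γ with hgdef
  have hpow : ∀ (n : ℕ) (x : M), g.zpow n x = γ ^ n • x := by
    intro n x
    induction n with
    | zero => rw [pow_zero, one_smul]; rfl
    | succ n ih =>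
      rw [Nat.cast_succ, add_comm, Diffeomorph.zpow_add_apply, ih, Diffeomorph.zpow_one_apply,
        pow_succ', mul_smul]
      rfl
  have hg : ∀ x : M, g.zpow r x = x := by
    intro x
    have hγr : γ ^ r = 1 := by
      have h := pow_card_eq_one (x := γ)
      rwa [Fintype.card_multiplicative, ZMod.card] at h
    rw [hpow, hγr, one_smul]
  have hfix : MulAction.fixedPoints (Multiplicative (ZMod r)) M = {x | g x = x} := by
    ext x
    refine ⟨fun h => h γ, fun h a => ?_⟩
    -- A point fixed by the generator is fixed by the whole group, so `F` is the fixed point set of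
    -- `g`.
    have h1 : Subgroup.zpowers γ ≤ MulAction.stabilizer (Multiplicative (ZMod r)) x := by
      rw [Subgroup.zpowers_le]
      exact h
    rw [hγ] at h1
    exact h1 (Subgroup.mem_top a)
  refine ⟨hiso.exists_isSymplecticForm hη hf, suspensionAction hg,
    by let _ := suspensionAction hg; exact ⟨contMDiff_suspensionSMul hg⟩,
    fixedPoints_suspensionAction hg, ?_, ?_⟩
  · rw [hfix]
    exact areDiffeomorphicSubsets_stabilizer hg
  · rw [hfix]
    rintro hns ⟨σ, hσ, hinv⟩
    exact hns (isSymplecticSubset_of_invariant hg hσ hinv)
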